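/- Let $d\ge 0$, $s,k,r\ge 0$ be integers with $r\ge k$, let $\gamma\in(0,1]$, $\Omega\subset\mathbb R^d$, let $z\in\mathbb R^d$ and let $X=\{x_1,\dots,x_N\}$ consist of $N\ge1$ distinct points, such that $S_{z,X}:=\bigcup_{i=1}^N[z,x_i]\subset\Omega$. Let $\Pi^d_q$ be the space of real $d$-variate polynomials of total degree at most $q-1$ ($\Pi^d_0=\{0\}$), and let $Df=\sum_{|\alpha|\le k}a_\alpha\,\partial^\alpha f$ be a linear differential operator with variable real coefficients. Let $K:\Omega\times\Omega\to\mathbb R$ be a conditionally positive definite (cpd) kernel of order $s$: $K$ is symmetric, and $\sum_{i,j}c_ic_jK(y_i,y_j)>0$ for all finitely many distinct $y_1,\dots,y_n\in\Omega$ and all $c\in\mathbb R^n\setminus\{0\}$ with $\sum_j c_jp(y_j)=0$ for all $p\in\Pi^d_s$. Its native space $\mathcal F_K$ is the completion, realized as a space of functions on $\Omega$, of the space of functions $g=\sum_i c_iK(\cdot,y_i)+p$ with such $y,c$ (or $c=0$) and $p\in\Pi^d_s$, with respect to the seminorm $\|g\|_K=\big(\sum_{i,j}c_ic_jK(y_i,y_j)\big)^{1/2}$: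 it consists of the pointwise limits $f$ on $\Omega$ of sequences $(g_n)$ of such functions that are Cauchy in this seminorm, and $\|f\|_K=\lim_n\|g_n\|_K$. Assume that $K$ possesses continuous partial derivatives $\partial^{\alpha,\beta}K(x,y)=\partial_x^\alpha\partial_y^\beta K(x,y)$ for all $|\alpha|,|\beta|\le r$ and all $x,y\in S_{z,X}$; that is, for some open set $U$ with $S_{z,X}\subset U\subset\Omega$ they exist on $U\times U$, independently of the order of differentiation, and they are continuous at all points of $S_{z,X}\times S_{z,X}$. For a real function $V$ of two arguments in $S_{z,X}$ put $$|V|_{z,X,\gamma}:=\sup_{x,y\in S_{z,X}\setminus\{z\}}\frac{|V(x,y)-V(x,z)-V(z,y)+V(z,z)|}{\|x-z\|_2^\gamma\,\|y-z\|_2^\gamma}$$ (zero if $S_{z,X}=\{z\}$), and assume that $$|K|_{z,X,r+\gamma}:=\frac{1}{(\gamma+1)^2\cdots(\gamma+r)^2}\Big(\sum_{|\alpha|=r}\sum_{|\beta|=r}\frac{r!}{\alpha!}\,\frac{r!}{\beta!}\,\big|\partial^{\alpha,\beta}K\big|_{z,X,\gamma}^2\Big)^{1/2}<\infty .$$ Assume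 that the linear system $$\sum_{j=1}^N w_jp(x_j)=Dp(z)\qquad\text{for all }p\in\Pi^d_s\tag{1}$$ is consistent, i.e. has at least one solution $w\in\mathbb R^N$ ($X$ need not be a determining set for $\Pi^d_s$). Then there is exactly one $w^*\in\mathbb R^N$ that satisfies (1) and, for some $v\in\Pi^d_s$, $$\sum_{j=1}^N w^*_jK(x_i,x_j)+v(x_i)=D\big[K(\cdot,x_i)\big](z),\qquad 1\le i\le N .$$ Every $f\in\mathcal F_K$ possesses all partial derivatives of order at most $k$ in a neighbourhood of $z$, and $$\Big|Df(z)-\sum_{j=1}^N w^*_jf(x_j)\Big|\le\rho_{q,D}(z,X,r+\gamma)\,|K|_{z,X,r+\gamma}^{1/2}\,\|f\|_K,\qquad q=\max\{s,r+1\},$$ where $$\rho_{q,D}(z,X,\mu):=\sup\big\{Dp(z):p\in\Pi^d_q,\ |p(x_j)|\le\|x_j-z\|_2^\mu,\ j=1,\dots,N\big\}\in[0,\infty]$$ (the bound is regarded as void if $\rho_{q,D}(z,X,r+\gamma)=\infty$). -/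

import Mathlib

open Filter Topology
open scoped ENNReal

noncomputable section

namespace KernelDiff

/-- The Euclidean space `ℝ^d`. -/
abbrev Space (d : ℕ) := EuclideanSpace ℝ (Fin d)

/-! ### Polynomials -/

/-- `Π^d_q`: the real `d`-variate polynomials of total degree at most `q - 1`, i.e. `< q`
(so it is `{0}` for `q = 0`). -/
def polySpace (d q : ℕ) : Submodule ℝ (MvPolynomial (Fin d) ℝ) :=
  MvPolynomial.restrictSupport ℝ {m : Fin d →₀ ℕ | m.degree < q}

/-- The function on `ℝ^d` defined by a polynomial. -/
def polyFun {d : ℕ} (p : MvPolynomial (Fin d) ℝ) (x : Space d) : ℝ :=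
  MvPolynomial.eval (fun i => x i) p

/-! ### Partial derivatives and differential operators -/

/-- The `i`-th coordinate vector. -/
def coordVec {d : ℕ} (i : Fin d) : Space d := EuclideanSpace.single i (1 : ℝ)

/-- The first order partial derivative with respect to the `i`-th coordinate. -/
def pderivCoord {d : ℕ} (i : Fin d) (f : Space d → ℝ) : Space d → ℝ :=
  fun x => lineDeriv ℝ f x (coordVec i)

/-- The iterated partial derivative `∂^α f`, for a multi-index `α`. -/
def partialD {d : ℕ} (α : Fin d → ℕ) (f : Space d → ℝ) : Space d → ℝ :=
  (List.finRange d).foldr (fun i g => (pderivCoord i)^[α i] g) f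

/-- The order `|α|` of a multi-index. -/
def order {d : ℕ} (α : Fin d → ℕ) : ℕ := ∑ i, α i

/-- All partial derivatives of `f` of order at most `k` exist at every point of `V`, and do not
depend on the order of differentiation. -/
def HasPartialsOn {d : ℕ} (k : ℕ) (f : Space d → ℝ) (V : Set (Space d)) : Prop :=
  ∀ α : Fin d → ℕ, order α < k → ∀ i : Fin d, ∀ x ∈ V,
    HasLineDerivAt ℝ (partialD α f) (partialD (α + Pi.single i 1) f x) x (coordVec i)

/-- The linear differential operator `D f = ∑_{|α| ≤ k} a_α ∂^α f` with variable coefficients. -/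
def diffOp {d : ℕ} (k : ℕ) (a : (Fin d → ℕ) → Space d → ℝ) (f : Space d → ℝ) (x : Space d) : ℝ :=
  ∑ n ∈ Finset.range (k + 1), ∑ α ∈ Finset.piAntidiag (Finset.univ : Finset (Fin d)) n,
    a α x * partialD α f x

/-- `∂^{α,β} K(x, y)`: first `∂^β` in the second argument, then `∂^α` in the first one. -/
def kernelPartial {d : ℕ} (α β : Fin d → ℕ) (K : Space d → Space d → ℝ) (x y : Space d) : ℝ :=
  partialD α (fun x' => partialD β (fun y' => K x' y') y) x

/-- `K` possesses continuous partial derivatives `∂^{α,β} K(x, y)`, `|α|, |β| ≤ r`, for all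
`x, y ∈ S`: they exist and are independent of the order of differentiation near `S × S`
(on `U × U`, for some open `U` between `S` and the domain `Ω` of the kernel), and they are
continuous at every point of `S × S`. -/
def HasContKernelPartials {d : ℕ} (r : ℕ) (K : Space d → Space d → ℝ) (Ω S : Set (Space d)) :
    Prop :=
  ∃ U : Set (Space d), IsOpen U ∧ S ⊆ U ∧ U ⊆ Ω ∧
    ∀ α β : Fin d → ℕ, order α ≤ r → order β ≤ r →
      (order α < r → ∀ i : Fin d, ∀ x ∈ U, ∀ y ∈ U,
        HasLineDerivAt ℝ (fun x' => kernelPartial α β K x' y)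
          (kernelPartial (α + Pi.single i 1) β K x y) x (coordVec i)) ∧
      (order β < r → ∀ i : Fin d, ∀ x ∈ U, ∀ y ∈ U,
        HasLineDerivAt ℝ (fun y' => kernelPartial α β K x y')
          (kernelPartial α (β + Pi.single i 1) K x y) y (coordVec i)) ∧
      (∀ x ∈ S, ∀ y ∈ S,
        ContinuousAt (fun u : Space d × Space d => kernelPartial α β K u.1 u.2) (x, y))

/-! ### Conditionally positive definite kernels and their native spaces

Functions on `Ω` are represented by functions on `ℝ^d` of which only the values on `Ω` matter,
and kernels on `Ω × Ω` likewise. -/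

/-- A finitely supported coefficient vector `c` on points of `Ω` that satisfies the moment
conditions `∑ c_x p(x) = 0` for all `p ∈ Π^d_s`. -/
def IsMomentFree {d : ℕ} (Ω : Set (Space d)) (s : ℕ) (c : Space d →₀ ℝ) : Prop :=
  (∀ x ∈ c.support, x ∈ Ω) ∧ ∀ p ∈ polySpace d s, (c.sum fun x cx => cx * polyFun p x) = 0

/-- The quadratic form `∑_{x,y} c_x c_y K(x, y)`. -/
def kernelForm {d : ℕ} (K : Space d → Space d → ℝ) (c : Space d →₀ ℝ) : ℝ :=
  c.sum fun x cx => c.sum fun y cy => cx * cy * K x y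

/-- `K` is a symmetric conditionally positive definite kernel of order `s` on `Ω`
(strictly positive definite for `s = 0`). -/
def IsCPD {d : ℕ} (s : ℕ) (Ω : Set (Space d)) (K : Space d → Space d → ℝ) : Prop :=
  (∀ x ∈ Ω, ∀ y ∈ Ω, K x y = K y x) ∧
    ∀ c : Space d →₀ ℝ, IsMomentFree Ω s c → c ≠ 0 → 0 < kernelForm K c

/-- The function `∑_x c_x K(·, x) + p`. -/
def kernelSum {d : ℕ} (K : Space d → Space d → ℝ) (c : Space d →₀ ℝ)
    (p : MvPolynomial (Fin d) ℝ) (x : Space d) : ℝ :=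
  (c.sum fun y cy => cy * K x y) + polyFun p x

/-- `f : Ω → ℝ` is represented in the completion, with seminorm `ν`: it is the pointwise limit
on `Ω` of a sequence of functions `g_n = ∑ c_x K(·, x) + p` (with `c = c_n` moment free and
`p = p_n ∈ Π^d_s`) that is Cauchy for the seminorm `‖g_n‖ = (∑_{x,y} c_x c_y K(x, y))^{1/2}`, and
`ν = lim ‖g_n‖`. -/
def HasNativeNorm {d : ℕ} (s : ℕ) (Ω : Set (Space d)) (K : Space d → Space d → ℝ)
    (f : Space d → ℝ) (ν : ℝ) : Prop :=
  ∃ (c : ℕ → Space d →₀ ℝ) (p : ℕ → MvPolynomial (Fin d) ℝ),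
    (∀ n, IsMomentFree Ω s (c n) ∧ p n ∈ polySpace d s) ∧
    (∀ ε > 0, ∃ n₀, ∀ m ≥ n₀, ∀ n ≥ n₀, √(kernelForm K (c m - c n)) < ε) ∧
    (∀ x ∈ Ω, Tendsto (fun n => kernelSum K (c n) (p n) x) atTop (𝓝 (f x))) ∧
    Tendsto (fun n => √(kernelForm K (c n))) atTop (𝓝 ν)

/-- Membership in the native space `F_K` on `Ω`. -/
def InNativeSpace {d : ℕ} (s : ℕ) (Ω : Set (Space d)) (K : Space d → Space d → ℝ)
    (f : Space d → ℝ) : Prop :=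
  ∃ ν : ℝ, HasNativeNorm s Ω K f ν

/-- The seminorm `‖f‖_K` of the native space: for `f ∈ F_K` and a cpd kernel `K` the set below
has exactly one element, since the limit of the seminorms does not depend on the sequence. -/
def nativeNorm {d : ℕ} (s : ℕ) (Ω : Set (Space d)) (K : Space d → Space d → ℝ)
    (f : Space d → ℝ) : ℝ :=
  sInf {ν : ℝ | HasNativeNorm s Ω K f ν}

/-! ### The numerical differentiation formula -/

/-- The linear system of polynomial exactness, `∑_j w_j p(x_j) = D p(z)` for `p ∈ Π^d_s`. -/
def PolyExact {d N : ℕ} (s k : ℕ) (a : (Fin d → ℕ) → Space d → ℝ) (z : Space d)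
    (x : Fin N → Space d) (w : Fin N → ℝ) : Prop :=
  ∀ p ∈ polySpace d s, ∑ j, w j * polyFun p (x j) = diffOp k a (polyFun p) z

/-- `w` is the weight part of a solution of the linear system that defines the kernel-based
formula. The polynomial `v ∈ Π^d_s` is `∑_j v_j p_j` for a basis `p_1, …, p_M` of `Π^d_s`. -/
def IsKernelWeights {d N : ℕ} (s k : ℕ) (a : (Fin d → ℕ) → Space d → ℝ)
    (K : Space d → Space d → ℝ) (z : Space d) (x : Fin N → Space d) (w : Fin N → ℝ) : Prop :=
  (∃ v ∈ polySpace d s, ∀ i,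
    ∑ j, w j * K (x i) (x j) + polyFun v (x i) = diffOp k a (fun u => K u (x i)) z) ∧
  PolyExact s k a z x w

/-- `S_{z,X} = ⋃_i [z, x_i]`. -/
def starSet {d N : ℕ} (z : Space d) (x : Fin N → Space d) : Set (Space d) :=
  ⋃ i, segment ℝ z (x i)

/-- `|U|_{z,X,γ}`, with values in `[0, ∞]`. -/
def mixedHolder {d N : ℕ} (z : Space d) (x : Fin N → Space d) (γ : ℝ)
    (U : Space d → Space d → ℝ) : ℝ≥0∞ :=
  ⨆ u ∈ starSet z x \ {z}, ⨆ v ∈ starSet z x \ {z},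
    ENNReal.ofReal (|U u v - U u z - U z v + U z z| / (‖u - z‖ ^ γ * ‖v - z‖ ^ γ))

/-- `|K|_{z,X,r+γ}`, with values in `[0, ∞]`. -/
def kernelHolder {d N : ℕ} (z : Space d) (x : Fin N → Space d) (r : ℕ) (γ : ℝ)
    (K : Space d → Space d → ℝ) : ℝ≥0∞ :=
  ENNReal.ofReal (1 / ∏ j ∈ Finset.Icc 1 r, (γ + j) ^ 2) *
    (∑ α ∈ Finset.piAntidiag (Finset.univ : Finset (Fin d)) r,
      ∑ β ∈ Finset.piAntidiag (Finset.univ : Finset (Fin d)) r,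
        (Nat.multinomial Finset.univ α : ℝ≥0∞) * (Nat.multinomial Finset.univ β : ℝ≥0∞) *
          mixedHolder z x γ (kernelPartial α β K) ^ 2) ^ (1 / 2 : ℝ)

/-- The growth function `ρ_{q,D}(z, X, μ)`, with values in `[0, ∞]`. -/
def growthFunction {d N : ℕ} (q k : ℕ) (a : (Fin d → ℕ) → Space d → ℝ) (z : Space d)
    (x : Fin N → Space d) (μ : ℝ) : EReal :=
  sSup {t : EReal | ∃ p ∈ polySpace d q, (∀ j, |polyFun p (x j)| ≤ ‖x j - z‖ ^ μ) ∧
    t = ((diffOp k a (polyFun p) z : ℝ) : EReal)}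

end KernelDiff

end

noncomputable section

namespace KernelDiff

/-! ### Families of partial derivatives -/

/-! Write λ_w for the error functional f ↦ Df(z) - ∑ w_j f(x_j). The kernel gives a semi-inner
product on the finitely supported functionals that annihilate Π_s; complete it to a Hilbert space H.
A finite polynomial reproduction turns each point evaluation into such a functional, δ_u - ∑ p_m(u)
μ_m, whose class φ(u) is a feature map: every native f equals ⟨φ(·), ξ⟩ plus a polynomial of Π_s,
where ‖ξ‖ ≤ ν for the norm value ν (`IsCPD.exists_featureMap`).

Near z the map φ has weak partial derivatives: squared norms of its difference quotients are mixed
second differences of the kernel, hence bounded, and the quotients converge against a dense set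
(`exists_weakDerivatives`). So f is differentiable near z, and for w exact on Π_s one has λ_w(f) =
⟨Λ(w), ξ⟩, where Λ(w) is the formula's error on φ. The system defining w* says that Λ(w*) is
orthogonal to Λ(w') - Λ(w*) for every w' exact on Π_s, so ‖Λ(w*)‖ ≤ ‖Λ(w')‖
(`IsCPD.exists_error_bound`).

One good competitor w' is therefore enough. The number ‖Λ(w')‖² is λ_{w'} applied to both arguments
of K. If w' is exact up to degree r, only tensor product Taylor remainders at the nodes survive, and
`abs_taylor_remainder_le` bounds the result by |K| (∑ |w'_j| ‖x_j - z‖^(r+γ))². Linear programming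
duality (`exists_weights_of_bound`) supplies a w', exact on Π_q, for which this last sum is at most
ρ. Existence and uniqueness of w* are linear algebra based on conditional positive definiteness. -/

/-- `F` behaves on `V` like the family of the partial derivatives up to order `n` of `F 0`. -/
def IsPartialFamily {d : ℕ} (n : ℕ) (F : (Fin d → ℕ) → Space d → ℝ) (V : Set (Space d)) : Prop :=
  ∀ α : Fin d → ℕ, order α < n → ∀ i : Fin d, ∀ x ∈ V,
    HasLineDerivAt ℝ (F α) (F (α + Pi.single i 1) x) x (coordVec i)

section MultiIndex

variable {d : ℕ}

@[simp] lemma order_zero : order (0 : Fin d → ℕ) = 0 := by simp [order]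

lemma order_add (α β : Fin d → ℕ) : order (α + β) = order α + order β := by
  simp [order, Finset.sum_add_distrib]

@[simp] lemma order_single (i : Fin d) (m : ℕ) : order (Pi.single i m : Fin d → ℕ) = m := by
  simp [order]

lemma mem_piAntidiag_univ {j : ℕ} {α : Fin d → ℕ} :
    α ∈ Finset.piAntidiag (Finset.univ : Finset (Fin d)) j ↔ order α = j := by
  simp [order]

/-- There are finitely many multi-indices of order at most `r`. -/
lemma finite_order_le (r : ℕ) : {α : Fin d → ℕ | order α ≤ r}.Finite := by
  refine (Set.finite_Iic (fun _ : Fin d => r)).subset fun α hα i => ?_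
  exact (Finset.single_le_sum (f := α) (fun _ _ => Nat.zero_le _) (Finset.mem_univ i)).trans hα

end MultiIndex

section Family

variable {d : ℕ} {n : ℕ} {F G : (Fin d → ℕ) → Space d → ℝ} {V : Set (Space d)}

lemma hasLineDerivAt_iff {f : Space d → ℝ} {f' : ℝ} {x v : Space d} :
    HasLineDerivAt ℝ f f' x v ↔ HasDerivAt (fun t : ℝ => f (x + t • v)) f' 0 := Iff.rfl

lemma IsPartialFamily.mono (h : IsPartialFamily n F V) {m : ℕ} (hm : m ≤ n) {W : Set (Space d)}
    (hW : W ⊆ V) : IsPartialFamily m F W :=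
  fun α hα i x hx => h α (hα.trans_le hm) i x (hW hx)

lemma IsPartialFamily.add (hF : IsPartialFamily n F V) (hG : IsPartialFamily n G V) :
    IsPartialFamily n (fun α x => F α x + G α x) V :=
  fun α hα i x hx => HasDerivAt.add (hF α hα i x hx) (hG α hα i x hx)

lemma IsPartialFamily.sub (hF : IsPartialFamily n F V) (hG : IsPartialFamily n G V) :
    IsPartialFamily n (fun α x => F α x - G α x) V :=
  fun α hα i x hx => HasDerivAt.sub (hF α hα i x hx) (hG α hα i x hx)

lemma IsPartialFamily.const_mul (c : ℝ) (hF : IsPartialFamily n F V) :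
    IsPartialFamily n (fun α x => c * F α x) V :=
  fun α hα i x hx => HasDerivAt.const_mul c (hF α hα i x hx)

lemma IsPartialFamily.sum {ι : Type*} (A : Finset ι) {F : ι → (Fin d → ℕ) → Space d → ℝ}
    (hF : ∀ m ∈ A, IsPartialFamily n (F m) V) :
    IsPartialFamily n (fun α x => ∑ m ∈ A, F m α x) V :=
  fun α hα i x hx => HasDerivAt.fun_sum fun m hm => hF m hm α hα i x hx

lemma pderivCoord_eqOn (hV : IsOpen V) {g h : Space d → ℝ} (hgh : Set.EqOn g h V) (i : Fin d)
    {h' : Space d → ℝ} (hh : ∀ x ∈ V, HasLineDerivAt ℝ h (h' x) x (coordVec i)) :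
    Set.EqOn (pderivCoord i g) h' V := fun x hx =>
  ((hh x hx).congr_of_eventuallyEq (hgh.eventuallyEq_of_mem (hV.mem_nhds hx))).lineDeriv

/-- A family of partial derivatives of `f` consists of the iterated partial derivatives. -/
lemma IsPartialFamily.partialD_eqOn (hF : IsPartialFamily n F V) (hV : IsOpen V) {f : Space d → ℝ}
    (hf : Set.EqOn f (F 0) V) {α : Fin d → ℕ} (hα : order α ≤ n) :
    Set.EqOn (partialD α f) (F α) V := by
  -- The fold defining `partialD` is followed one coordinate at a time; the sum over the list is the
  -- multi-index of the derivatives taken so far.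
  have key : ∀ l : List (Fin d), order ((l.map fun i => Pi.single i (α i)).sum) ≤ n →
      Set.EqOn (l.foldr (fun i g => (pderivCoord i)^[α i] g) f)
        (F ((l.map fun i => Pi.single i (α i)).sum)) V := by
    intro l
    induction l with
    | nil => intro _; simpa using hf
    | cons i l ih =>
      intro hl
      simp only [List.map_cons, List.sum_cons, order_add, order_single] at hl
      have ih' := ih (by omega)
      simp only [List.map_cons, List.sum_cons, List.foldr_cons]
      have h2 : ∀ m ≤ α i, Set.EqOn
          ((pderivCoord i)^[m] (l.foldr (fun i g => (pderivCoord i)^[α i] g) f))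
          (F (Pi.single i m + (l.map fun i => Pi.single i (α i)).sum)) V := by
        intro m
        induction m with
        | zero => intro _; simpa using ih'
        | succ m ihm =>
          intro hm
          rw [Function.iterate_succ_apply']
          refine pderivCoord_eqOn hV (ihm (by omega)) i fun x hx => ?_
          have := hF (Pi.single i m + (l.map fun i => Pi.single i (α i)).sum)
            (by rw [order_add, order_single]; omega) i x hx
          rwa [add_right_comm, ← Pi.single_add] at this
      exact h2 _ le_rfl
  have hsum : (((List.finRange d).map fun i => Pi.single i (α i)).sum : Fin d → ℕ) = α := by
    rw [← List.ofFn_eq_map, List.sum_ofFn]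
    exact Finset.univ_sum_single α
  have := key (List.finRange d) (by rwa [hsum])
  rwa [hsum] at this

lemma IsPartialFamily.hasPartialsOn (hF : IsPartialFamily n F V) (hV : IsOpen V) {f : Space d → ℝ}
    (hf : Set.EqOn f (F 0) V) : HasPartialsOn n f V := by
  intro α hα i x hx
  rw [hF.partialD_eqOn hV hf (by rw [order_add, order_single]; omega) hx]
  exact (hF α hα i x hx).congr_of_eventuallyEq
    ((hF.partialD_eqOn hV hf hα.le).eventuallyEq_of_mem (hV.mem_nhds hx))

@[simp] lemma partialD_zero (f : Space d → ℝ) : partialD 0 f = f := by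
  have : ∀ l : List (Fin d),
      l.foldr (fun i g => (pderivCoord i)^[(0 : Fin d → ℕ) i] g) f = f := by
    intro l
    induction l with
    | nil => rfl
    | cons i l ih => simp
  exact this _

lemma IsPartialFamily.diffOp_eq (hF : IsPartialFamily n F V) (hV : IsOpen V) {f : Space d → ℝ}
    (hf : Set.EqOn f (F 0) V) {k : ℕ} (hk : k ≤ n) (a : (Fin d → ℕ) → Space d → ℝ)
    {z : Space d} (hz : z ∈ V) :
    diffOp k a f z = ∑ n ∈ Finset.range (k + 1),
      ∑ α ∈ Finset.piAntidiag (Finset.univ : Finset (Fin d)) n, a α z * F α z := by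
  refine Finset.sum_congr rfl fun m hm => Finset.sum_congr rfl fun α hα => ?_
  rw [mem_piAntidiag_univ] at hα
  rw [Finset.mem_range] at hm
  rw [hF.partialD_eqOn hV hf (by omega) hz]

end Family

/-! ### Polynomials -/

section Poly

variable {d : ℕ}

lemma hasLineDerivAt_coord (i j : Fin d) (x : Space d) :
    HasLineDerivAt ℝ (fun y : Space d => y i) (if i = j then 1 else 0) x (coordVec j) := by
  rw [hasLineDerivAt_iff]
  have h : (fun t : ℝ => (x + t • coordVec j : Space d) i)
      = fun t : ℝ => x i + t * (if i = j then 1 else 0) := by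
    funext t
    simp [coordVec]
  rw [h]
  simpa using ((hasDerivAt_id (0 : ℝ)).mul_const (if i = j then (1 : ℝ) else 0)).const_add (x i)

lemma exists_partialFamily_polyFun (p : MvPolynomial (Fin d) ℝ) :
    ∃ F : (Fin d → ℕ) → Space d → ℝ, F 0 = polyFun p ∧ (∀ α, Continuous (F α)) ∧
      ∀ n, IsPartialFamily n F Set.univ := by
  induction p using MvPolynomial.induction_on with
  | C c =>
    refine ⟨fun α _ => if α = 0 then c else 0, ?_, fun α => continuous_const, ?_⟩
    · ext x; simp [polyFun]
    · intro n α _ i x _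
      have : α + Pi.single i 1 ≠ 0 := fun h => by
        have := congrArg order h
        rw [order_add, order_single, order_zero] at this
        omega
      beta_reduce
      rw [if_neg this]
      exact hasDerivAt_const _ _
  | add p q hp hq =>
    obtain ⟨F, hF, hFc, hFp⟩ := hp
    obtain ⟨G, hG, hGc, hGp⟩ := hq
    refine ⟨fun α x => F α x + G α x, ?_, fun α => (hFc α).add (hGc α), fun n =>
      (hFp n).add (hGp n)⟩
    ext x
    simp [hF, hG, polyFun]
  | mul_X p i hp =>
    obtain ⟨F, hF, hFc, hFp⟩ := hp
    -- Leibniz rule: ∂^α(x_i f) = x_i ∂^α f + α_i ∂^(α-e_i) f. Truncated subtraction is harmless,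
    -- since for α_i = 0 the second term has the factor 0.
    refine ⟨fun α x => x i * F α x + α i * F (α - Pi.single i 1) x, ?_, fun α => ?_, ?_⟩
    · ext x
      simp [hF, polyFun, mul_comm]
    · have := hFc α
      have := hFc (α - Pi.single i 1)
      fun_prop
    · intro n α _ j x _
      have h1 := (hasLineDerivAt_coord i j x)
      have h2 := hFp (order α + 1) α (by omega) j x trivial
      have h3 := hFp (order (α - Pi.single i 1) + 1) (α - Pi.single i 1) (by omega) j x trivial
      rw [hasLineDerivAt_iff] at h1 h2 h3 ⊢
      have h4 := (h1.mul h2).add (h3.const_mul (α i : ℝ))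
      simp only [zero_smul, add_zero] at h4
      convert! h4 using 1
      rcases eq_or_ne i j with rfl | hij
      · have e1 : α + Pi.single i 1 - Pi.single i 1 = α := by ext; simp
        beta_reduce
        rw [e1]
        rcases Nat.eq_zero_or_pos (α i) with h0 | h0
        · simp [h0]; ring
        · have e2 : α - Pi.single i 1 + Pi.single i 1 = α := by
            ext j
            rcases eq_or_ne j i with rfl | hj
            · simp; omega
            · simp [hj]
          rw [e2]
          simp; ring
      · have e1 : α + Pi.single j 1 - Pi.single i 1 = α - Pi.single i 1 + Pi.single j 1 := by
          ext l
          rcases eq_or_ne l i with rfl | hl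
          · simp [hij]
          · simp [hl]
        beta_reduce
        rw [e1]
        simp [hij]

lemma isPartialFamily_polyFun (p : MvPolynomial (Fin d) ℝ) (n : ℕ) :
    IsPartialFamily n (fun α => partialD α (polyFun p)) Set.univ := by
  obtain ⟨F, hF, -, hFp⟩ := exists_partialFamily_polyFun p
  exact (hFp n).hasPartialsOn isOpen_univ (fun x _ => by rw [hF])

lemma continuous_partialD_polyFun (p : MvPolynomial (Fin d) ℝ) (α : Fin d → ℕ) :
    Continuous (partialD α (polyFun p)) := by
  obtain ⟨F, hF, hFc, hFp⟩ := exists_partialFamily_polyFun p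
  have : partialD α (polyFun p) = F α := by
    ext x
    exact (hFp (order α)).partialD_eqOn isOpen_univ (fun x _ => by rw [hF]) le_rfl trivial
  rw [this]
  exact hFc α

/-- Evaluation at a point, as a linear functional on polynomials. -/
def polyEval (x : Space d) : MvPolynomial (Fin d) ℝ →ₗ[ℝ] ℝ :=
  (MvPolynomial.aeval (fun i => x i)).toLinearMap

lemma polyEval_apply (x : Space d) (p : MvPolynomial (Fin d) ℝ) : polyEval x p = polyFun p x := by
  simp [polyEval, polyFun, MvPolynomial.aeval_eq_eval]

lemma polySpace_mono {q q' : ℕ} (h : q ≤ q') : polySpace d q ≤ polySpace d q' :=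
  MvPolynomial.restrictSupport_mono ℝ fun _ hm => lt_of_lt_of_le hm h

lemma mem_polySpace_succ_iff {q : ℕ} {p : MvPolynomial (Fin d) ℝ} :
    p ∈ polySpace d (q + 1) ↔ p.totalDegree ≤ q := by
  rw [polySpace, MvPolynomial.mem_restrictSupport_iff, MvPolynomial.totalDegree,
    Finset.sup_le_iff]
  exact forall_congr' fun m => imp_congr_right fun _ => Nat.lt_succ_iff

instance (q : ℕ) : FiniteDimensional ℝ (polySpace d q) := by
  have : Finite {m : Fin d →₀ ℕ | m.degree < q} := by
    refine Set.Finite.subset (Set.Finite.preimage (f := fun m : Fin d →₀ ℕ => (m : Fin d → ℕ))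
      DFunLike.coe_injective.injOn (finite_order_le q)) fun m hm => ?_
    rw [Set.mem_ofPred_eq, Finsupp.degree_eq_sum] at hm
    exact hm.le
  exact Module.Finite.of_basis (MvPolynomial.basisRestrictSupport ℝ _)

end Poly

/-! ### Directional derivatives of higher order -/

section DirSum

variable {d : ℕ}

/-- The `j`-th derivative in the direction `h`, in terms of the partial derivatives `G`. -/
def dirSum (j : ℕ) (h : Space d) (G : (Fin d → ℕ) → ℝ) : ℝ :=
  ∑ α ∈ Finset.piAntidiag (Finset.univ : Finset (Fin d)) j,
    (Nat.multinomial Finset.univ α : ℝ) * (∏ i, h i ^ α i) * G α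

lemma dirSum_zero (h : Space d) (G : (Fin d → ℕ) → ℝ) : dirSum 0 h G = G 0 := by
  simp [dirSum, Nat.multinomial]

/-- Umbral form, by the multinomial theorem: the linear functional X^m ↦ G m is applied to (∑ h_i
X_i)^j. The recursion in j then comes from `pow_succ`, because multiplication by X_i shifts G by
e_i. -/
lemma dirSum_eq_basis (j : ℕ) (h : Space d) (G : (Fin d → ℕ) → ℝ) :
    (MvPolynomial.basisMonomials (Fin d) ℝ).constr ℝ (fun m : Fin d →₀ ℕ => G m)
      ((∑ i, MvPolynomial.C (h i) * MvPolynomial.X i) ^ j) = dirSum j h G := by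
  rw [Finset.sum_pow_eq_sum_piAntidiag, map_sum, dirSum]
  refine Finset.sum_congr rfl fun α _ => ?_
  have h1 : (Nat.multinomial Finset.univ α : MvPolynomial (Fin d) ℝ) *
      ∏ i, (MvPolynomial.C (h i) * MvPolynomial.X i) ^ α i
      = ((Nat.multinomial Finset.univ α : ℝ) * ∏ i, h i ^ α i) •
        MvPolynomial.basisMonomials (Fin d) ℝ (Finsupp.equivFunOnFinite.symm α) := by
    rw [MvPolynomial.coe_basisMonomials]
    beta_reduce
    rw [MvPolynomial.monomial_eq, MvPolynomial.smul_eq_C_mul]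
    simp only [mul_pow, Finset.prod_mul_distrib, map_mul, map_prod, map_pow, map_natCast, map_one,
      one_mul, mul_assoc]
    rw [Finsupp.prod_fintype _ _ (by simp)]
    simp
  rw [h1, map_smul, Module.Basis.constr_basis]
  simp

lemma dirSum_succ (j : ℕ) (h : Space d) (G : (Fin d → ℕ) → ℝ) :
    dirSum (j + 1) h G = ∑ i, h i * dirSum j h (fun α => G (α + Pi.single i 1)) := by
  rw [← dirSum_eq_basis, pow_succ, Finset.mul_sum, map_sum]
  refine Finset.sum_congr rfl fun i _ => ?_
  rw [← dirSum_eq_basis]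
  generalize (∑ i, MvPolynomial.C (h i) * MvPolynomial.X i) ^ j = p
  induction p using MvPolynomial.induction_on' with
  | add p q hp hq => rw [add_mul, map_add, hp, hq, map_add, mul_add]
  | monomial m c =>
    have h1 : ∀ (m : Fin d →₀ ℕ) (c : ℝ), MvPolynomial.monomial m c
        = c • MvPolynomial.basisMonomials (Fin d) ℝ m := by
      intro m c
      simp [MvPolynomial.smul_monomial]
    rw [← MvPolynomial.monomial_zero', MvPolynomial.X, MvPolynomial.monomial_mul,
      MvPolynomial.monomial_mul, h1, h1, map_smul, map_smul, Module.Basis.constr_basis,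
      Module.Basis.constr_basis]
    simp only [smul_eq_mul, zero_add, Finsupp.coe_add, mul_one]
    rw [Finsupp.single_eq_pi_single]
    ring

lemma dirSum_congr {j : ℕ} {h : Space d} {G G' : (Fin d → ℕ) → ℝ}
    (hG : ∀ α, order α = j → G α = G' α) : dirSum j h G = dirSum j h G' :=
  Finset.sum_congr rfl fun α hα => by rw [hG α (mem_piAntidiag_univ.1 hα)]

lemma dirSum_eq_zero {j : ℕ} {h : Space d} {G : (Fin d → ℕ) → ℝ}
    (hG : ∀ α, order α = j → G α = 0) : dirSum j h G = 0 :=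
  Finset.sum_eq_zero fun α hα => by rw [hG α (mem_piAntidiag_univ.1 hα), mul_zero]

lemma dirSum_sub (j : ℕ) (h : Space d) (G G' : (Fin d → ℕ) → ℝ) :
    dirSum j h (fun α => G α - G' α) = dirSum j h G - dirSum j h G' := by
  simp only [dirSum, ← Finset.sum_sub_distrib, mul_sub]

lemma dirSum_const_mul (j : ℕ) (h : Space d) (c : ℝ) (G : (Fin d → ℕ) → ℝ) :
    dirSum j h (fun α => c * G α) = c * dirSum j h G := by
  rw [dirSum, dirSum, Finset.mul_sum]
  exact Finset.sum_congr rfl fun α _ => by ring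

lemma dirSum_sum (j : ℕ) (h : Space d) {ι : Type*} (A : Finset ι) (G : ι → (Fin d → ℕ) → ℝ) :
    dirSum j h (fun α => ∑ m ∈ A, G m α) = ∑ m ∈ A, dirSum j h (G m) := by
  simp only [dirSum, Finset.mul_sum]
  exact Finset.sum_comm

lemma dirSum_comm (j l : ℕ) (h h' : Space d) (G : (Fin d → ℕ) → (Fin d → ℕ) → ℝ) :
    dirSum j h (fun α => dirSum l h' (G α)) = dirSum l h' (fun β => dirSum j h fun α => G α β) := by
  simp only [dirSum, Finset.mul_sum]
  rw [Finset.sum_comm]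
  exact Finset.sum_congr rfl fun α _ => Finset.sum_congr rfl fun β _ => by ring

lemma hasDerivAt_dirSum {j : ℕ} {h : Space d} {G : ℝ → (Fin d → ℕ) → ℝ} {G' : (Fin d → ℕ) → ℝ}
    {t : ℝ} (hG : ∀ α, order α = j → HasDerivAt (fun t => G t α) (G' α) t) :
    HasDerivAt (fun t => dirSum j h (G t)) (dirSum j h G') t :=
  HasDerivAt.fun_sum fun α hα => (hG α (mem_piAntidiag_univ.1 hα)).const_mul _

/-- The Cauchy-Schwarz inequality for directional derivatives. -/
lemma dirSum_sq_le (j : ℕ) (h : Space d) (G : (Fin d → ℕ) → ℝ) :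
    dirSum j h G ^ 2 ≤ ‖h‖ ^ (2 * j) *
      ∑ α ∈ Finset.piAntidiag (Finset.univ : Finset (Fin d)) j,
        (Nat.multinomial Finset.univ α : ℝ) * G α ^ 2 := by
  -- The multinomial theorem for (∑ h_i²)^j. Below, each multinomial coefficient is split into two
  -- square roots before applying Cauchy-Schwarz.
  have h1 : ‖h‖ ^ (2 * j) = ∑ α ∈ Finset.piAntidiag (Finset.univ : Finset (Fin d)) j,
      (Nat.multinomial Finset.univ α : ℝ) * (∏ i, h i ^ α i) ^ 2 := by
    rw [pow_mul, EuclideanSpace.norm_sq_eq, Finset.sum_pow_eq_sum_piAntidiag]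
    refine Finset.sum_congr rfl fun α _ => ?_
    rw [← Finset.prod_pow]
    congr 1
    refine Finset.prod_congr rfl fun i _ => ?_
    rw [Real.norm_eq_abs, sq_abs, ← pow_mul, ← pow_mul, mul_comm]
  rw [h1]
  have := Finset.sum_mul_sq_le_sq_mul_sq
    (Finset.piAntidiag (Finset.univ : Finset (Fin d)) j)
    (fun α => √(Nat.multinomial Finset.univ α : ℝ) * ∏ i, h i ^ α i)
    (fun α => √(Nat.multinomial Finset.univ α : ℝ) * G α)
  have h2 : ∀ α : Fin d → ℕ, √(Nat.multinomial Finset.univ α : ℝ) * (∏ i, h i ^ α i) *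
      (√(Nat.multinomial Finset.univ α : ℝ) * G α)
      = (Nat.multinomial Finset.univ α : ℝ) * (∏ i, h i ^ α i) * G α := fun α => by
    linear_combination ((∏ i, h i ^ α i) * G α) *
      Real.mul_self_sqrt (Nat.cast_nonneg (α := ℝ) (Nat.multinomial Finset.univ α))
  simp only [h2, mul_pow, Real.sq_sqrt (Nat.cast_nonneg (α := ℝ) _)] at this
  exact this

/-- Product rule on the recursion `dirSum_succ`: one copy of the result comes from differentiating
the coordinate factor, the others from the induction hypothesis. -/
lemma hasLineDerivAt_dirSum (j : ℕ) (z x : Space d) (i : Fin d) (G : (Fin d → ℕ) → ℝ) :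
    HasLineDerivAt ℝ (fun x => dirSum (j + 1) (x - z) G)
      ((j + 1) * dirSum j (x - z) fun α => G (α + Pi.single i 1)) x (coordVec i) := by
  induction j generalizing G with
  | zero =>
    have h : ∀ y : Space d, dirSum (0 + 1) (y - z) G
        = ∑ l, (y - z) l * G (0 + Pi.single l 1) := by
      intro y
      rw [dirSum_succ]
      simp only [dirSum_zero]
    simp only [h, dirSum_zero]
    have h2 : ∀ l ∈ (Finset.univ : Finset (Fin d)),
        HasDerivAt (fun t : ℝ => (x + t • coordVec i - z) l * G (0 + Pi.single l 1))
          ((if l = i then 1 else 0) * G (0 + Pi.single l 1)) 0 := by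
      intro l _
      have := (hasLineDerivAt_iff.1 (hasLineDerivAt_coord l i x)).sub_const (z l)
      exact this.mul_const _
    have := HasDerivAt.fun_sum h2
    rw [hasLineDerivAt_iff]
    convert! this using 1
    simp
  | succ j ih =>
    have h2 : ∀ l ∈ (Finset.univ : Finset (Fin d)),
        HasDerivAt (fun t : ℝ => (x + t • coordVec i - z) l *
            dirSum (j + 1) (x + t • coordVec i - z) (fun α => G (α + Pi.single l 1)))
          ((if l = i then 1 else 0) * dirSum (j + 1) (x - z) (fun α => G (α + Pi.single l 1)) +
            (x - z) l * ((j + 1) * dirSum j (x - z)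
              fun α => G (α + Pi.single i 1 + Pi.single l 1))) 0 := by
      intro l _
      have h3 := (hasLineDerivAt_iff.1 (hasLineDerivAt_coord l i x)).sub_const (z l)
      have h4 := h3.mul (hasLineDerivAt_iff.1 (ih (fun α => G (α + Pi.single l 1))))
      simpa only [zero_smul, add_zero] using! h4
    have h5 := HasDerivAt.fun_sum h2
    rw [hasLineDerivAt_iff]
    simp only [dirSum_succ (j + 1)]
    convert! h5 using 1
    rw [Finset.sum_add_distrib]
    simp only [ite_mul, one_mul, zero_mul, Finset.sum_ite_eq', Finset.mem_univ, if_true]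
    have h6 : ∑ l, (x - z) l * ((j + 1) * dirSum j (x - z)
        fun α => G (α + Pi.single i 1 + Pi.single l 1))
        = (j + 1) * dirSum (j + 1) (x - z) fun α => G (α + Pi.single i 1) := by
      rw [dirSum_succ, Finset.mul_sum]
      refine Finset.sum_congr rfl fun l _ => ?_
      simp only [add_right_comm _ (Pi.single l 1)]
      ring
    rw [h6]
    push_cast
    ring

/-- The value at `z + h` of the Taylor polynomial with partial derivatives `G` at `z`. -/
def taylorSum (r : ℕ) (h : Space d) (G : (Fin d → ℕ) → ℝ) : ℝ :=
  ∑ j ∈ Finset.range (r + 1), dirSum j h G / (j.factorial : ℝ)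

lemma exists_polyFun_eq_dirSum (j : ℕ) (z : Space d) (G : (Fin d → ℕ) → ℝ) :
    ∃ p : MvPolynomial (Fin d) ℝ, p.totalDegree ≤ j ∧ ∀ x, polyFun p x = dirSum j (x - z) G := by
  induction j generalizing G with
  | zero => exact ⟨MvPolynomial.C (G 0), by simp, fun x => by simp [polyFun, dirSum_zero]⟩
  | succ j ih =>
    choose p hp hpe using fun i : Fin d => ih (fun α => G (α + Pi.single i 1))
    refine ⟨∑ i, (MvPolynomial.X i - MvPolynomial.C (z i)) * p i, ?_, fun x => ?_⟩
    · refine MvPolynomial.totalDegree_finsetSum_le fun i _ => ?_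
      refine (MvPolynomial.totalDegree_mul _ _).trans ?_
      have h1 := MvPolynomial.totalDegree_sub_C_le (MvPolynomial.X (R := ℝ) i) (z i)
      rw [MvPolynomial.totalDegree_X] at h1
      have := hp i
      omega
    · rw [dirSum_succ]
      simp only [← hpe]
      simp [polyFun]

/-- There is a polynomial with prescribed partial derivatives at a point. -/
lemma exists_taylorPoly (r : ℕ) (z : Space d) (G : (Fin d → ℕ) → ℝ) :
    ∃ p ∈ polySpace d (r + 1), (∀ α, order α ≤ r → partialD α (polyFun p) z = G α) ∧
      ∀ x, polyFun p x = taylorSum r (x - z) G := by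
  choose p hp hpe using fun j => exists_polyFun_eq_dirSum j z G
  have hP : ∀ x, polyFun (∑ j ∈ Finset.range (r + 1), MvPolynomial.C ((j.factorial : ℝ)⁻¹) * p j) x
      = taylorSum r (x - z) G := by
    intro x
    simp only [taylorSum, ← hpe]
    simp [polyFun, div_eq_inv_mul]
  refine ⟨_, ?_, ?_, hP⟩
  · rw [mem_polySpace_succ_iff]
    refine MvPolynomial.totalDegree_finsetSum_le fun j hj => ?_
    refine (MvPolynomial.totalDegree_mul _ _).trans ?_
    have := hp j
    rw [Finset.mem_range] at hj
    rw [MvPolynomial.totalDegree_C]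
    omega
  -- Cutting `G` off above order r closes the family under differentiation: the degree r term of the
  -- shifted Taylor sum involves only orders above r and vanishes.
  · set G' : (Fin d → ℕ) → ℝ := fun α => if order α ≤ r then G α else 0 with hG'
    have hfam : ∀ n, IsPartialFamily n
        (fun α x => taylorSum r (x - z) fun β => G' (β + α)) Set.univ := by
      intro n α _ i x _
      have h1 : ∀ j ∈ Finset.range r,
          HasDerivAt (fun t : ℝ => dirSum (j + 1) (x + t • coordVec i - z) (fun β => G' (β + α))
            / ((j + 1).factorial : ℝ))
          (dirSum j (x - z) (fun β => G' (β + (α + Pi.single i 1))) / (j.factorial : ℝ)) 0 := by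
        intro j _
        have h2 := (hasLineDerivAt_iff.1
          (hasLineDerivAt_dirSum j z x i fun β => G' (β + α))).div_const ((j + 1).factorial : ℝ)
        convert! h2 using 1
        rw [Nat.factorial_succ]
        push_cast
        have : (j.factorial : ℝ) ≠ 0 := by positivity
        have : (j + 1 : ℝ) ≠ 0 := by positivity
        simp only [add_right_comm _ (Pi.single i 1) α, ← add_assoc]
        field_simp
      have h3 := (HasDerivAt.fun_sum h1).add_const (G' (0 + α))
      rw [hasLineDerivAt_iff]
      have h4 : (fun t : ℝ => taylorSum r (x + t • coordVec i - z) fun β => G' (β + α))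
          = fun t => ∑ j ∈ Finset.range r,
            dirSum (j + 1) (x + t • coordVec i - z) (fun β => G' (β + α))
            / ((j + 1).factorial : ℝ) + G' (0 + α) := by
        funext t
        rw [taylorSum, Finset.sum_range_succ']
        simp [dirSum_zero]
      beta_reduce
      rw [h4]
      convert! h3 using 1
      rw [taylorSum, Finset.sum_range_succ]
      rw [dirSum_eq_zero (j := r), zero_div, add_zero]
      intro β hβ
      rw [hG']
      refine if_neg ?_
      rw [order_add, order_add, order_single]
      omega
    intro α hα
    have h5 : Set.EqOn (polyFun (∑ j ∈ Finset.range (r + 1),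
        MvPolynomial.C ((j.factorial : ℝ)⁻¹) * p j))
        ((fun (α : Fin d → ℕ) (x : Space d) => taylorSum r (x - z) fun β => G' (β + α)) 0)
        Set.univ := by
      intro x _
      rw [hP]
      refine Finset.sum_congr rfl fun j hj => ?_
      rw [Finset.mem_range] at hj
      congr 1
      refine dirSum_congr fun β hβ => ?_
      rw [hG', add_zero]
      exact (if_pos (by omega)).symm
    rw [(hfam (order α)).partialD_eqOn isOpen_univ h5 le_rfl trivial]
    simp only [sub_self, taylorSum]
    rw [Finset.sum_range_succ', Finset.sum_eq_zero]
    · simp [dirSum_zero, hG', hα]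
    · intro j _
      rw [dirSum_succ]
      simp

end DirSum

/-! ### Taylor remainders -/

lemma _root_.HasLineDerivAt.hasDerivAt_add_smul {E : Type*} [AddCommGroup E] [Module ℝ E]
    {f : E → ℝ} {f' : ℝ} {x v : E} {s : ℝ} (h : HasLineDerivAt ℝ f f' (x + s • v) v) :
    HasDerivAt (fun u : ℝ => f (x + u • v)) f' s := by
  have := HasDerivAt.comp_sub_const s s (f := fun t : ℝ => f (x + s • v + t • v))
    (by rw [sub_self]; exact h)
  convert! this using 1
  funext u
  congr 1
  module

lemma abs_sub_le_of_hasLineDerivAt {E : Type*} [AddCommGroup E] [Module ℝ E] {f f' : E → ℝ}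
    {x v : E} {h C : ℝ}
    (hf : ∀ s ∈ Set.uIcc 0 h, HasLineDerivAt ℝ f (f' (x + s • v)) (x + s • v) v)
    (hC : ∀ s ∈ Set.uIcc 0 h, |f' (x + s • v)| ≤ C) : |f (x + h • v) - f x| ≤ C * |h| := by
  have := Convex.norm_image_sub_le_of_norm_hasDerivWithin_le
    (fun s hs => (hf s hs).hasDerivAt_add_smul.hasDerivWithinAt) hC (convex_uIcc 0 h)
    Set.left_mem_uIcc Set.right_mem_uIcc
  simpa using this

/-- Partial derivatives that exist near a point and are continuous there give all the directional
derivatives. -/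
lemma hasLineDerivAt_of_continuousAt_partials {d : ℕ} {f : Space d → ℝ} {g : Fin d → Space d → ℝ}
    {x₀ : Space d} (h : ∀ᶠ x in 𝓝 x₀, ∀ i, HasLineDerivAt ℝ f (g i x) x (coordVec i))
    (hg : ∀ i, ContinuousAt (g i) x₀) (a : Space d) :
    HasLineDerivAt ℝ f (∑ i, a i * g i x₀) x₀ a := by
  -- The direction is built up coordinate by coordinate. Each step adds an increment along e_i based
  -- at the moving point x₀ + tb.
  have key : ∀ A : Finset (Fin d),
      HasLineDerivAt ℝ f (∑ i ∈ A, a i * g i x₀) x₀ (∑ i ∈ A, a i • coordVec i) := by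
    intro A
    induction A using Finset.induction_on with
    | empty => simpa using hasLineDerivAt_zero
    | insert i A hi ih =>
      rw [Finset.sum_insert hi, Finset.sum_insert hi]
      set b : Space d := ∑ i ∈ A, a i • coordVec i
      have hstep : HasDerivAt
          (fun t : ℝ => f (x₀ + t • (a i • coordVec i + b)) - f (x₀ + t • b)) (a i * g i x₀) 0 := by
        rw [hasDerivAt_iff_isLittleO_nhds_zero, Asymptotics.isLittleO_iff]
        intro c hc
        have hε : 0 < c / (|a i| + 1) := by positivity
        obtain ⟨δ, hδ, hball⟩ := Metric.eventually_nhds_iff.1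
          (h.and (Metric.tendsto_nhds.1 (hg i) _ hε))
        -- For |t| below this bound, all points x₀ + tb + s e_i with |s| ≤ |t a_i| stay within δ of
        -- x₀.
        have hη : 0 < δ / (‖b‖ + |a i| * ‖(coordVec i : Space d)‖ + 1) := by positivity
        filter_upwards [Metric.ball_mem_nhds (0 : ℝ) hη] with t ht
        rw [mem_ball_zero_iff, Real.norm_eq_abs, lt_div_iff₀ (by positivity)] at ht
        have hin : ∀ s ∈ Set.uIcc 0 (t * a i), dist (x₀ + t • b + s • coordVec i) x₀ < δ := by
          intro s hs
          have hs' : |s| ≤ |t| * |a i| := by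
            have := Set.abs_sub_left_of_mem_uIcc hs
            rwa [sub_zero, sub_zero, abs_mul] at this
          rw [dist_eq_norm, add_assoc, add_sub_cancel_left]
          calc ‖t • b + s • (coordVec i : Space d)‖ ≤ |t| * ‖b‖ + |s| * ‖(coordVec i : Space d)‖ := by
                refine (norm_add_le _ _).trans ?_
                rw [norm_smul, norm_smul, Real.norm_eq_abs, Real.norm_eq_abs]
            _ ≤ |t| * ‖b‖ + |t| * |a i| * ‖(coordVec i : Space d)‖ := by gcongr
            _ ≤ |t| * (‖b‖ + |a i| * ‖(coordVec i : Space d)‖ + 1) := by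
                nlinarith [abs_nonneg t]
            _ < δ := ht
        -- Subtracting the linear term s g_i(x₀) leaves a derivative that continuity at x₀ makes
        -- small, so the mean value inequality gives the little-o bound.
        have hder : ∀ s ∈ Set.uIcc 0 (t * a i), HasDerivWithinAt
            (fun s : ℝ => f (x₀ + t • b + s • coordVec i) - s * g i x₀)
            (g i (x₀ + t • b + s • coordVec i) - g i x₀) (Set.uIcc 0 (t * a i)) s := by
          intro s hs
          have h2 := ((hball (hin s hs)).1 i).hasDerivAt_add_smul
          have h3 := (h2.sub ((hasDerivAt_id s).mul_const (g i x₀))).hasDerivWithinAt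
            (s := Set.uIcc 0 (t * a i))
          rw [one_mul] at h3
          exact h3
        have hmv := Convex.norm_image_sub_le_of_norm_hasDerivWithin_le hder
          (C := c / (|a i| + 1)) (fun s hs => by
            have := (hball (hin s hs)).2
            rw [dist_eq_norm] at this
            exact this.le) (convex_uIcc 0 (t * a i)) Set.left_mem_uIcc Set.right_mem_uIcc
        have e1 : x₀ + t • (a i • coordVec i + b) = x₀ + t • b + (t * a i) • coordVec i := by
          module
        simp only [zero_add, zero_smul, add_zero, sub_self, sub_zero, smul_eq_mul, e1]
        simp only [zero_smul, add_zero, zero_mul, sub_zero] at hmv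
        calc ‖f (x₀ + t • b + (t * a i) • coordVec i) - f (x₀ + t • b) - t * (a i * g i x₀)‖
            = ‖f (x₀ + t • b + (t * a i) • coordVec i) - t * a i * g i x₀ - f (x₀ + t • b)‖ := by
              congr 1; ring
          _ ≤ c / (|a i| + 1) * ‖t * a i‖ := hmv
          _ = c * ‖t‖ * (|a i| / (|a i| + 1)) := by
              rw [norm_mul, Real.norm_eq_abs (a i)]; ring
          _ ≤ c * ‖t‖ * 1 := by
              gcongr
              rw [div_le_one (by positivity)]
              linarith
          _ = c * ‖t‖ := mul_one _
      have := hstep.add (hasLineDerivAt_iff.1 ih)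
      rw [hasLineDerivAt_iff]
      convert! this using 1
      funext t
      simp
  have h1 := key Finset.univ
  have h2 : (∑ i, a i • coordVec i : Space d) = a := by
    ext j
    simp [coordVec, Pi.single_apply]
  rwa [h2] at h1

/-- The derivative of the remainder is the remainder of one order less for the shifted sequence.
Integrating t^γ r times produces the denominators γ+1, …, γ+r; integration is replaced by comparison
with the explicit primitive. -/
lemma abs_sub_taylor_le (r : ℕ) {γ C : ℝ} (hγ : 0 < γ) (g : ℕ → ℝ → ℝ)
    (hg : ∀ j < r, ∀ t ∈ Set.Icc (0 : ℝ) 1, HasDerivAt (g j) (g (j + 1) t) t)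
    (hC : ∀ t ∈ Set.Icc (0 : ℝ) 1, |g r t - g r 0| ≤ C * t ^ γ) :
    ∀ t ∈ Set.Icc (0 : ℝ) 1,
      |g 0 t - ∑ j ∈ Finset.range (r + 1), g j 0 * (t ^ j / (j.factorial : ℝ))| ≤
        C / (∏ j ∈ Finset.Icc 1 r, (γ + j)) * t ^ (γ + r) := by
  induction r generalizing g with
  | zero =>
    intro t ht
    simpa using hC t ht
  | succ r ih =>
    have ih' := ih (fun j => g (j + 1)) (fun j hj => hg (j + 1) (by omega)) hC
    set f : ℝ → ℝ := fun t =>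
      g 0 t - ∑ j ∈ Finset.range (r + 1 + 1), g j 0 * (t ^ j / (j.factorial : ℝ)) with hf
    have hder : ∀ t ∈ Set.Icc (0 : ℝ) 1, HasDerivAt f
        (g 1 t - ∑ j ∈ Finset.range (r + 1), g (j + 1) 0 * (t ^ j / (j.factorial : ℝ))) t := by
      intro t ht
      have h1 : ∀ j ∈ Finset.range (r + 1), HasDerivAt
          (fun t : ℝ => g (j + 1) 0 * (t ^ (j + 1) / ((j + 1).factorial : ℝ)))
          (g (j + 1) 0 * (t ^ j / (j.factorial : ℝ))) t := by
        intro j _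
        have := ((hasDerivAt_pow (j + 1) t).div_const ((j + 1).factorial : ℝ)).const_mul
          (g (j + 1) 0)
        convert! this using 1
        rw [Nat.factorial_succ]
        have : (j.factorial : ℝ) ≠ 0 := by positivity
        push_cast
        have : (j + 1 : ℝ) ≠ 0 := by positivity
        field_simp
      have h2 := (hg 0 (by omega) t ht).sub ((HasDerivAt.fun_sum h1).add_const
        (g 0 0 * (t ^ 0 / (Nat.factorial 0 : ℝ))))
      convert! h2 using 1
      funext u
      simp only [hf, Finset.sum_range_succ' _ (r + 1), Pi.sub_apply, pow_zero]
    have hP : 0 < ∏ j ∈ Finset.Icc 1 r, (γ + j) :=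
      Finset.prod_pos fun j _ => by positivity
    have hB : ∀ t : ℝ, HasDerivAt
        (fun t : ℝ => C / (∏ j ∈ Finset.Icc 1 (r + 1), (γ + j)) * t ^ (γ + (r + 1 : ℕ)))
        (C / (∏ j ∈ Finset.Icc 1 r, (γ + j)) * t ^ (γ + r)) t := by
      intro t
      have h1 : (1 : ℝ) ≤ γ + (r + 1 : ℕ) := by
        push_cast
        have : (0 : ℝ) ≤ r := by positivity
        linarith
      have := (Real.hasDerivAt_rpow_const (x := t) (Or.inr h1)).const_mul
        (C / (∏ j ∈ Finset.Icc 1 (r + 1), (γ + j)))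
      convert! this using 1
      rw [Finset.prod_Icc_succ_top (by omega)]
      have e : γ + ((r + 1 : ℕ) : ℝ) - 1 = γ + r := by push_cast; ring
      rw [e]
      have : γ + ((r + 1 : ℕ) : ℝ) ≠ 0 := by positivity
      field_simp
    have hf0 : f 0 = 0 := by
      simp only [hf, Finset.sum_range_succ' _ (r + 1)]
      simp
    refine image_norm_le_of_norm_deriv_right_le_deriv_boundary (f := f)
      (fun t ht => (hder t ht).continuousAt.continuousWithinAt)
      (fun t ht => (hder t (Set.Ico_subset_Icc_self ht)).hasDerivWithinAt) ?_ hB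
      (fun t ht => ih' t (Set.Ico_subset_Icc_self ht))
    rw [hf0, Real.zero_rpow (by positivity)]
    simp

section Remainder

variable {d : ℕ}

/-- Here `F α t` stands for the partial derivative at the point z + ta of a segment. The
one-variable estimate is applied to the directional derivatives t ↦ `dirSum j a`. -/
lemma abs_sub_taylorSum_le {r : ℕ} {γ C : ℝ} (hγ : 0 < γ) (a : Space d)
    (F : (Fin d → ℕ) → ℝ → ℝ)
    (hF : ∀ α, order α < r → ∀ t ∈ Set.Icc (0 : ℝ) 1,
      HasDerivAt (F α) (∑ i, a i * F (α + Pi.single i 1) t) t)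
    (hC : ∀ t ∈ Set.Icc (0 : ℝ) 1,
      |dirSum r a (fun α => F α t - F α 0)| ≤ C * t ^ γ) :
    |F 0 1 - taylorSum r a (fun α => F α 0)| ≤ C / ∏ j ∈ Finset.Icc 1 r, (γ + j) := by
  have h := abs_sub_taylor_le r hγ (fun j t => dirSum j a fun α => F α t) (C := C) ?_
    (fun t ht => by rw [← dirSum_sub]; exact hC t ht) 1 (by simp)
  · simpa [dirSum_zero, taylorSum, div_eq_mul_inv] using h
  · intro j hj t ht
    have h1 := hasDerivAt_dirSum (j := j) (h := a) (G := fun t α => F α t) (t := t)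
      (fun α hα => hF α (by omega) t ht)
    convert! h1 using 1
    rw [dirSum_sum, dirSum_succ]
    exact Finset.sum_congr rfl fun i _ => (dirSum_const_mul ..).symm

lemma taylorSum_sub (r : ℕ) (h : Space d) (G G' : (Fin d → ℕ) → ℝ) :
    taylorSum r h (fun α => G α - G' α) = taylorSum r h G - taylorSum r h G' := by
  simp only [taylorSum, dirSum_sub, sub_div, Finset.sum_sub_distrib]

lemma taylorSum_const_mul (r : ℕ) (h : Space d) (c : ℝ) (G : (Fin d → ℕ) → ℝ) :
    taylorSum r h (fun α => c * G α) = c * taylorSum r h G := by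
  simp only [taylorSum, dirSum_const_mul, mul_div_assoc, Finset.mul_sum]

lemma taylorSum_sum (r : ℕ) (h : Space d) {ι : Type*} (A : Finset ι)
    (G : ι → (Fin d → ℕ) → ℝ) :
    taylorSum r h (fun α => ∑ m ∈ A, G m α) = ∑ m ∈ A, taylorSum r h (G m) := by
  simp only [taylorSum, dirSum_sum, Finset.sum_div]
  exact Finset.sum_comm

lemma hasDerivAt_taylorSum {r : ℕ} {h : Space d} {G : ℝ → (Fin d → ℕ) → ℝ}
    {G' : (Fin d → ℕ) → ℝ} {t : ℝ}
    (hG : ∀ α, order α ≤ r → HasDerivAt (fun t => G t α) (G' α) t) :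
    HasDerivAt (fun t => taylorSum r h (G t)) (taylorSum r h G') t := by
  refine HasDerivAt.fun_sum fun j hj => HasDerivAt.div_const (hasDerivAt_dirSum fun α hα => hG α ?_) _
  rw [Finset.mem_range] at hj
  omega

lemma dirSum_taylorSum_comm (j r : ℕ) (h h' : Space d)
    (G : (Fin d → ℕ) → (Fin d → ℕ) → ℝ) :
    dirSum j h (fun α => taylorSum r h' (G α)) =
      taylorSum r h' (fun β => dirSum j h fun α => G α β) := by
  simp only [taylorSum]
  rw [dirSum_sum]
  refine Finset.sum_congr rfl fun l _ => ?_
  rw [← dirSum_comm]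
  simp only [div_eq_inv_mul]
  rw [dirSum_const_mul]

/-- Cauchy-Schwarz in α and then in β; the multinomial weights are those of the Hölder seminorm of
the kernel. -/
lemma dirSum_dirSum_sq_le (r : ℕ) (a b : Space d) (G c : (Fin d → ℕ) → (Fin d → ℕ) → ℝ)
    (hG : ∀ α β, order α = r → order β = r → |G α β| ≤ c α β) :
    |dirSum r a fun α => dirSum r b (G α)| ≤ ‖a‖ ^ r * ‖b‖ ^ r *
      √(∑ α ∈ Finset.piAntidiag (Finset.univ : Finset (Fin d)) r,
        ∑ β ∈ Finset.piAntidiag (Finset.univ : Finset (Fin d)) r,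
          (Nat.multinomial Finset.univ α : ℝ) * (Nat.multinomial Finset.univ β : ℝ) *
            c α β ^ 2) := by
  refine abs_le_of_sq_le_sq (α := ℝ) ?_ (by positivity)
  rw [mul_pow, Real.sq_sqrt (Finset.sum_nonneg fun α _ => Finset.sum_nonneg fun β _ => by
    positivity)]
  calc _ ≤ ‖a‖ ^ (2 * r) * ∑ α ∈ Finset.piAntidiag (Finset.univ : Finset (Fin d)) r,
        (Nat.multinomial Finset.univ α : ℝ) * (dirSum r b (G α)) ^ 2 := dirSum_sq_le _ _ _
    _ ≤ ‖a‖ ^ (2 * r) * ∑ α ∈ Finset.piAntidiag (Finset.univ : Finset (Fin d)) r,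
        (Nat.multinomial Finset.univ α : ℝ) * (‖b‖ ^ (2 * r) *
          ∑ β ∈ Finset.piAntidiag (Finset.univ : Finset (Fin d)) r,
            (Nat.multinomial Finset.univ β : ℝ) * c α β ^ 2) := by
        gcongr with α hα
        refine (dirSum_sq_le _ _ _).trans ?_
        refine mul_le_mul_of_nonneg_left (Finset.sum_le_sum fun β hβ =>
          mul_le_mul_of_nonneg_left ?_ (by positivity)) (by positivity)
        have := abs_le.1 (hG α β (mem_piAntidiag_univ.1 hα) (mem_piAntidiag_univ.1 hβ))
        exact sq_le_sq' this.1 this.2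
    _ = _ := by
        simp only [Finset.mul_sum]
        refine Finset.sum_congr rfl fun α _ => Finset.sum_congr rfl fun β _ => ?_
        ring

/-- The remainder of the tensor product Taylor expansion in two variables, along the segments with
directions `a` and `b`. -/
lemma abs_taylor_remainder_le {r : ℕ} {γ : ℝ} (hγ : 0 < γ) (a b : Space d)
    (M : (Fin d → ℕ) → (Fin d → ℕ) → ℝ → ℝ → ℝ) (c : (Fin d → ℕ) → (Fin d → ℕ) → ℝ)
    (hM₁ : ∀ α β, order α < r → order β ≤ r → ∀ t ∈ Set.Icc (0 : ℝ) 1, ∀ τ ∈ Set.Icc (0 : ℝ) 1,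
      HasDerivAt (fun t => M α β t τ) (∑ i, a i * M (α + Pi.single i 1) β t τ) t)
    (hM₂ : ∀ α β, order α ≤ r → order β < r → ∀ t ∈ Set.Icc (0 : ℝ) 1, ∀ τ ∈ Set.Icc (0 : ℝ) 1,
      HasDerivAt (fun τ => M α β t τ) (∑ i, b i * M α (β + Pi.single i 1) t τ) τ)
    (hc : ∀ α β, order α = r → order β = r → ∀ t ∈ Set.Icc (0 : ℝ) 1, ∀ τ ∈ Set.Icc (0 : ℝ) 1,
      |M α β t τ - M α β t 0 - M α β 0 τ + M α β 0 0| ≤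
        c α β * ((t * ‖a‖) ^ γ * (τ * ‖b‖) ^ γ)) :
    |(M 0 0 1 1 - taylorSum r b (fun β => M 0 β 1 0)) -
      taylorSum r a (fun α => M α 0 0 1 - taylorSum r b (fun β => M α β 0 0))| ≤
      ‖a‖ ^ (r + γ) * ‖b‖ ^ (r + γ) * ((1 / ∏ j ∈ Finset.Icc 1 r, (γ + j) ^ 2) *
      √(∑ α ∈ Finset.piAntidiag (Finset.univ : Finset (Fin d)) r,
        ∑ β ∈ Finset.piAntidiag (Finset.univ : Finset (Fin d)) r,
          (Nat.multinomial Finset.univ α : ℝ) * (Nat.multinomial Finset.univ β : ℝ) *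
            c α β ^ 2)) := by
  set Q : ℝ := √(∑ α ∈ Finset.piAntidiag (Finset.univ : Finset (Fin d)) r,
        ∑ β ∈ Finset.piAntidiag (Finset.univ : Finset (Fin d)) r,
          (Nat.multinomial Finset.univ α : ℝ) * (Nat.multinomial Finset.univ β : ℝ) *
            c α β ^ 2) with hQ
  set P : ℝ := ∏ j ∈ Finset.Icc 1 r, (γ + j) with hP
  have h0 : (0 : ℝ) ∈ Set.Icc (0 : ℝ) 1 := by simp
  have h1 : (1 : ℝ) ∈ Set.Icc (0 : ℝ) 1 := by simp
  -- One-variable estimate in τ, applied to the r-th a-derivative differenced between t and 0. Its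
  -- Hölder hypothesis in τ is then the mixed difference bound `hc`, and t^γ remains for the second
  -- application.
  have inner : ∀ t ∈ Set.Icc (0 : ℝ) 1,
      |dirSum r a (fun α => (M α 0 t 1 - taylorSum r b (fun β => M α β t 0)) -
        (M α 0 0 1 - taylorSum r b (fun β => M α β 0 0)))| ≤
      (‖a‖ ^ (r + γ) * ‖b‖ ^ (r + γ) * Q / P) * t ^ γ := by
    intro t ht
    have h2 := abs_sub_taylorSum_le (r := r) (C := ‖a‖ ^ (r + γ) * ‖b‖ ^ (r + γ) * Q * t ^ γ)
      hγ b (fun β τ => dirSum r a (fun α => M α β t τ - M α β 0 τ)) ?_ ?_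
    · refine le_of_eq_of_le ?_ (h2.trans_eq (by rw [mul_div_right_comm]))
      rw [← dirSum_taylorSum_comm, ← dirSum_sub]
      congr 2
      funext α
      rw [taylorSum_sub]
      ring
    · intro β hβ τ hτ
      have h3 := hasDerivAt_dirSum (j := r) (h := a) (t := τ)
        (G := fun τ α => M α β t τ - M α β 0 τ)
        (fun α hα => (hM₂ α β (by omega) hβ t ht τ hτ).sub (hM₂ α β (by omega) hβ 0 h0 τ hτ))
      convert! h3 using 1
      simp only [← Finset.sum_sub_distrib, ← mul_sub]
      rw [dirSum_sum]
      exact Finset.sum_congr rfl fun i _ => (dirSum_const_mul ..).symm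
    · intro τ hτ
      have h4 := dirSum_dirSum_sq_le r a b (fun α β => M α β t τ - M α β t 0 - M α β 0 τ + M α β 0 0)
        (fun α β => c α β * ((t * ‖a‖) ^ γ * (τ * ‖b‖) ^ γ))
        (fun α β hα hβ => hc α β hα hβ t ht τ hτ)
      have ht0 := ht.1
      have hτ0 := hτ.1
      have hy : 0 ≤ (t * ‖a‖) ^ γ * (τ * ‖b‖) ^ γ := by positivity
      have e : √(∑ α ∈ Finset.piAntidiag (Finset.univ : Finset (Fin d)) r,
          ∑ β ∈ Finset.piAntidiag (Finset.univ : Finset (Fin d)) r,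
          (Nat.multinomial Finset.univ α : ℝ) * (Nat.multinomial Finset.univ β : ℝ) *
            (c α β * ((t * ‖a‖) ^ γ * (τ * ‖b‖) ^ γ)) ^ 2)
          = Q * ((t * ‖a‖) ^ γ * (τ * ‖b‖) ^ γ) := by
        generalize (t * ‖a‖) ^ γ * (τ * ‖b‖) ^ γ = y at hy
        have h5 : ∀ α β, (Nat.multinomial Finset.univ α : ℝ) *
            (Nat.multinomial Finset.univ β : ℝ) * (c α β * y) ^ 2 =
            (Nat.multinomial Finset.univ α : ℝ) *
            (Nat.multinomial Finset.univ β : ℝ) * c α β ^ 2 * y ^ 2 := fun α β => by ring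
        simp only [h5, ← Finset.sum_mul]
        rw [Real.sqrt_mul' _ (by positivity), Real.sqrt_sq hy, hQ]
      rw [e, dirSum_comm] at h4
      refine le_of_eq_of_le ?_ (h4.trans_eq ?_)
      · simp only [← dirSum_sub]
        congr 2
        funext β
        congr 1
        funext α
        ring
      · rw [Real.mul_rpow ht0 (norm_nonneg _), Real.mul_rpow hτ0 (norm_nonneg _)]
        have ha : ‖a‖ ^ ((r : ℝ) + γ) = ‖a‖ ^ r * ‖a‖ ^ γ := by
          rw [Real.rpow_add_of_nonneg (norm_nonneg _) (by positivity) hγ.le, Real.rpow_natCast]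
        have hb : ‖b‖ ^ ((r : ℝ) + γ) = ‖b‖ ^ r * ‖b‖ ^ γ := by
          rw [Real.rpow_add_of_nonneg (norm_nonneg _) (by positivity) hγ.le, Real.rpow_natCast]
        rw [ha, hb]
        ring
  -- Same estimate in t for the Taylor remainder in the second variable. Each of the two
  -- applications contributes one factor 1/P.
  have h5 := abs_sub_taylorSum_le (r := r) hγ a
    (fun α t => M α 0 t 1 - taylorSum r b (fun β => M α β t 0)) ?_ inner
  · refine h5.trans_eq ?_
    rw [Finset.prod_pow, ← hP]
    have hPpos : 0 < P := Finset.prod_pos fun j _ => by positivity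
    field_simp
  · intro α hα t ht
    have h6 := (hM₁ α 0 hα (by simp) t ht 1 h1).sub (hasDerivAt_taylorSum (r := r) (h := b) (t := t)
      (G := fun t β => M α β t 0) (fun β hβ => hM₁ α β hα hβ t ht 0 h0))
    convert! h6 using 1
    rw [taylorSum_sum, ← Finset.sum_sub_distrib]
    refine Finset.sum_congr rfl fun i _ => ?_
    rw [taylorSum_const_mul]
    ring

end Remainder

/-! ### Hilbert spaces -/

/-- The bound makes D vanish on ker E, so D descends to the range of E and Hahn-Banach extends it.
This serves both the representation of native functions and the duality for weights. -/
lemma exists_dual_extension {W X : Type*} [AddCommGroup W] [Module ℝ W] [NormedAddCommGroup X]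
    [NormedSpace ℝ X] (E : W →ₗ[ℝ] X) (D : W →ₗ[ℝ] ℝ) {ρ : ℝ} (hρ : 0 ≤ ρ)
    (h : ∀ p, |D p| ≤ ρ * ‖E p‖) : ∃ g : StrongDual ℝ X, ‖g‖ ≤ ρ ∧ ∀ p, g (E p) = D p := by
  obtain ⟨g, hg⟩ := E.rangeRestrict.exists_rightInverse_of_surjective E.range_rangeRestrict
  have hg' : ∀ y : LinearMap.range E, E (g y) = y := fun y =>
    congrArg Subtype.val (LinearMap.congr_fun hg y)
  let ℓ : StrongDual ℝ (LinearMap.range E) := (D ∘ₗ g).mkContinuous ρ fun y => by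
    have := h (g y)
    rwa [hg'] at this
  obtain ⟨G, hG, hGn⟩ := exists_extension_norm_eq (LinearMap.range E) ℓ
  refine ⟨G, hGn ▸ LinearMap.mkContinuous_norm_le _ hρ _, fun p => ?_⟩
  have h1 := hG (E.rangeRestrict p)
  have h2 : ℓ (E.rangeRestrict p) = D (g (E.rangeRestrict p)) := rfl
  have h3 := h (g (E.rangeRestrict p) - p)
  have hr : (E.rangeRestrict p : X) = E p := rfl
  rw [map_sub, map_sub, hg', hr, sub_self, norm_zero, mul_zero] at h3
  have h4 := abs_nonpos_iff.1 h3
  rw [hr] at h1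
  rw [h1, h2]
  linarith

/-- The form may be degenerate; the completion identifies vectors at distance zero, so ι need not be
injective. -/
lemma exists_hilbert_completion {L : Type} [AddCommGroup L] [Module ℝ L]
    (B : L →ₗ[ℝ] L →ₗ[ℝ] ℝ) (hsymm : ∀ x y, B x y = B y x) (hpos : ∀ x, 0 ≤ B x x) :
    ∃ (H : Type) (_ : NormedAddCommGroup H) (_ : InnerProductSpace ℝ H) (_ : CompleteSpace H)
      (ι : L →ₗ[ℝ] H), DenseRange ι ∧ ∀ x y, inner ℝ (ι x) (ι y) = B x y := by
  let core : PreInnerProductSpace.Core ℝ L :=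
    { inner := fun x y => B x y
      conj_inner_symm := fun x y => hsymm y x
      re_inner_nonneg := fun x => hpos x
      add_left := fun x y z => by simp
      smul_left := fun x y r => by simp }
  let _ : SeminormedAddCommGroup L :=
    InnerProductSpace.Core.toSeminormedAddCommGroup (𝕜 := ℝ) (c := core)
  let _ : InnerProductSpace ℝ L := InnerProductSpace.ofCore core
  refine ⟨UniformSpace.Completion L, inferInstance, inferInstance, inferInstance,
    (UniformSpace.Completion.toComplL (𝕜 := ℝ) (E := L)).toLinearMap, ?_, ?_⟩
  · exact UniformSpace.Completion.denseRange_coe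
  · intro x y
    exact UniformSpace.Completion.inner_coe x y

section WeakLimit

variable {H : Type*} [NormedAddCommGroup H] [InnerProductSpace ℝ H] [CompleteSpace H]

/-- Boundedness extends convergence from the dense span to all of H; Banach-Steinhaus makes the
limit functional continuous, and Riesz represents it. -/
lemma exists_weak_limit {A : Type*} {q : A → H} {l : Filter A} [l.NeBot] [l.IsCountablyGenerated]
    {C : ℝ} (hC : ∀ᶠ h in l, ‖q h‖ ≤ C) {T : Set H} (hT : Dense (Submodule.span ℝ T : Set H))
    (hconv : ∀ t ∈ T, ∃ y, Tendsto (fun h => inner ℝ (q h) t) l (𝓝 y)) :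
    ∃ η : H, ∀ ξ, Tendsto (fun h => inner ℝ (q h) ξ) l (𝓝 (inner ℝ η ξ)) := by
  have hspan : ∀ ξ ∈ Submodule.span ℝ T, ∃ y, Tendsto (fun h => inner ℝ (q h) ξ) l (𝓝 y) := by
    intro ξ hξ
    induction hξ using Submodule.span_induction with
    | mem t ht => exact hconv t ht
    | zero => exact ⟨0, by simp⟩
    | add x y _ _ hx hy =>
      obtain ⟨a, ha⟩ := hx
      obtain ⟨b, hb⟩ := hy
      exact ⟨a + b, by simpa only [inner_add_right] using ha.add hb⟩
    | smul c x _ hx =>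
      obtain ⟨a, ha⟩ := hx
      exact ⟨c * a, by simpa only [inner_smul_right] using ha.const_mul c⟩
  have hC0 : 0 ≤ C := by
    obtain ⟨h, hh⟩ := hC.exists
    exact (norm_nonneg _).trans hh
  have hall : ∀ ξ, ∃ y, Tendsto (fun h => inner ℝ (q h) ξ) l (𝓝 y) := by
    intro ξ
    refine cauchy_map_iff_exists_tendsto.1 (Metric.cauchy_iff.2 ⟨inferInstance, fun ε hε => ?_⟩)
    -- C + 1 keeps the denominator positive when C = 0. The approximation error ε/3 and the limit
    -- error ε/6 add up to ε/2.
    obtain ⟨ξ', hξ', hd⟩ := Metric.mem_closure_iff.1 (hT ξ) (ε / (3 * (C + 1))) (by positivity)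
    obtain ⟨y, hy⟩ := hspan ξ' hξ'
    have h1 : ∀ᶠ h in l, |inner ℝ (q h) ξ - y| < ε / 2 := by
      filter_upwards [hC, Metric.tendsto_nhds.1 hy (ε / 6) (by positivity)] with h hh hh'
      rw [Real.dist_eq] at hh'
      have h2 : |inner ℝ (q h) (ξ - ξ')| ≤ ε / 3 := by
        refine (abs_real_inner_le_norm _ _).trans ?_
        rw [dist_eq_norm] at hd
        calc ‖q h‖ * ‖ξ - ξ'‖ ≤ (C + 1) * (ε / (3 * (C + 1))) := by
              gcongr
              linarith
          _ = ε / 3 := by field_simp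
      rw [inner_sub_right] at h2
      have h3 := abs_sub_le (inner ℝ (q h) ξ) (inner ℝ (q h) ξ') y
      linarith
    refine ⟨_, image_mem_map h1, ?_⟩
    rintro _ ⟨a, ha, rfl⟩ _ ⟨b, hb, rfl⟩
    rw [Real.dist_eq]
    have h3 := abs_sub_le (inner ℝ (q a) ξ) y (inner ℝ (q b) ξ)
    rw [abs_sub_comm y] at h3
    simp only [Set.mem_ofPred_eq] at ha hb
    linarith
  choose f hf using hall
  let ℓ : StrongDual ℝ H := continuousLinearMapOfTendsto (fun h => innerSL ℝ (q h)) (f := f)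
    (l := l) (tendsto_pi_nhds.2 hf)
  refine ⟨(InnerProductSpace.toDual ℝ H).symm ℓ, fun ξ => ?_⟩
  rw [InnerProductSpace.toDual_symm_apply]
  exact hf ξ

end WeakLimit

/-! ### Weak partial derivatives of a feature map -/

section WeakDerivatives

variable {d : ℕ} {H : Type*} [NormedAddCommGroup H] [InnerProductSpace ℝ H]
  {U V : Set (Space d)} {φ : Space d → H} {r : ℕ}
  {k : (Fin d → ℕ) → (Fin d → ℕ) → Space d → Space d → ℝ}

lemma IsPartialFamily.eqOn_of_eqOn_zero {n : ℕ} {F G : (Fin d → ℕ) → Space d → ℝ}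
    (hF : IsPartialFamily n F V) (hG : IsPartialFamily n G V) (hV : IsOpen V)
    (h : Set.EqOn (F 0) (G 0) V) {α : Fin d → ℕ} (hα : order α ≤ n) : Set.EqOn (F α) (G α) V :=
  fun _ hx => ((hF.partialD_eqOn hV (fun _ _ => rfl) hα) hx).symm.trans
    (hG.partialD_eqOn hV h hα hx)

/-- The inner products of weak derivatives of a feature map are derivatives of the kernel. -/
lemma inner_weakDerivatives_eq (hV : IsOpen V) (hVU : V ⊆ U)
    (hk₀ : ∀ u ∈ U, ∀ v ∈ U, k 0 0 u v = inner ℝ (φ u) (φ v))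
    (hk₁ : ∀ β, order β ≤ r → ∀ v ∈ U, IsPartialFamily r (fun α u => k α β u v) U)
    (hk₂ : ∀ α, order α ≤ r → ∀ u ∈ U, IsPartialFamily r (fun β v => k α β u v) U)
    {n : ℕ} (hn : n ≤ r) {Φ : (Fin d → ℕ) → Space d → H} (hΦ₀ : Φ 0 = φ)
    (hΦ : ∀ ξ, IsPartialFamily n (fun α u => inner ℝ (Φ α u) ξ) V) {α β : Fin d → ℕ}
    (hα : order α ≤ n) (hβ : order β ≤ n) {u v : Space d} (hu : u ∈ V ∨ (α = 0 ∧ u ∈ U))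
    (hv : v ∈ V ∨ (β = 0 ∧ v ∈ U)) : inner ℝ (Φ α u) (Φ β v) = k α β u v := by
  have hu' : u ∈ U := hu.elim (fun h => hVU h) And.right
  have key : ∀ v ∈ U, inner ℝ (Φ α u) (φ v) = k α 0 u v := by
    intro v hv
    rcases hu with hu | ⟨rfl, hu⟩
    · refine (hΦ (φ v)).eqOn_of_eqOn_zero ((hk₁ 0 (by simp) v hv).mono hn hVU) hV ?_ hα hu
      intro w hw
      simp only [hΦ₀]
      exact (hk₀ w (hVU hw) v hv).symm
    · rw [hΦ₀, hk₀ u hu v hv]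
  rcases hv with hv | ⟨rfl, hv⟩
  · rw [real_inner_comm]
    refine (hΦ (Φ α u)).eqOn_of_eqOn_zero ((hk₂ α (hα.trans hn) u hu').mono hn hVU) hV ?_ hβ hv
    intro w hw
    simp only [hΦ₀]
    rw [real_inner_comm]
    exact key w (hVU hw)
  · rw [hΦ₀]
    exact key v hv

/-- The mixed second difference of a function of two variables. -/
lemma abs_mixedDifference_le {f f₁ f₁₂ : Space d → Space d → ℝ} {u e : Space d} {h C : ℝ}
    (hf : ∀ s ∈ Set.uIcc 0 h, ∀ t ∈ Set.uIcc 0 h,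
      HasLineDerivAt ℝ (fun x => f x (u + t • e)) (f₁ (u + s • e) (u + t • e)) (u + s • e) e)
    (hf₁ : ∀ s ∈ Set.uIcc 0 h, ∀ t ∈ Set.uIcc 0 h,
      HasLineDerivAt ℝ (fun y => f₁ (u + s • e) y) (f₁₂ (u + s • e) (u + t • e)) (u + t • e) e)
    (hC : ∀ s ∈ Set.uIcc 0 h, ∀ t ∈ Set.uIcc 0 h, |f₁₂ (u + s • e) (u + t • e)| ≤ C) :
    |f (u + h • e) (u + h • e) - f (u + h • e) u - f u (u + h • e) + f u u| ≤ C * |h| ^ 2 := by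
  have h0 : (0 : ℝ) ∈ Set.uIcc 0 h := Set.left_mem_uIcc
  have h1 : h ∈ Set.uIcc 0 h := Set.right_mem_uIcc
  -- The mean value inequality in the first variable for the difference in the second; its
  -- derivative is bounded by the mean value inequality again.
  have h2 := abs_sub_le_of_hasLineDerivAt (f := fun x => f x (u + h • e) - f x u)
    (f' := fun x => f₁ x (u + h • e) - f₁ x u) (x := u) (v := e) (h := h) (C := C * |h|)
    (fun s hs => by
      have h3 := hf s hs 0 h0
      rw [zero_smul, add_zero] at h3
      exact HasDerivAt.sub (hf s hs h h1) h3)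
    (fun s hs => abs_sub_le_of_hasLineDerivAt (f' := fun y => f₁₂ (u + s • e) y) (hf₁ s hs)
      (hC s hs))
  rw [pow_two, ← mul_assoc]
  refine le_of_eq_of_le ?_ h2
  congr 1
  ring

variable [CompleteSpace H]

/-- A feature map whose kernel has locally bounded mixed partial derivatives has weak partial
derivatives. -/
lemma exists_weakDerivatives (hV : IsOpen V) (hVU : V ⊆ U)
    (hdense : Dense (Submodule.span ℝ (φ '' U) : Set H))
    (hk₀ : ∀ u ∈ U, ∀ v ∈ U, k 0 0 u v = inner ℝ (φ u) (φ v))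
    (hk₁ : ∀ β, order β ≤ r → ∀ v ∈ U, IsPartialFamily r (fun α u => k α β u v) U)
    (hk₂ : ∀ α, order α ≤ r → ∀ u ∈ U, IsPartialFamily r (fun β v => k α β u v) U)
    {C : (Fin d → ℕ) → ℝ}
    (hC : ∀ α, order α ≤ r → ∀ u ∈ V, ∀ v ∈ V, |k α α u v| ≤ C α) {n : ℕ} (hn : n ≤ r) :
    ∃ Φ : (Fin d → ℕ) → Space d → H, Φ 0 = φ ∧
      ∀ ξ, IsPartialFamily n (fun α u => inner ℝ (Φ α u) ξ) V := by
  classical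
  induction n with
  | zero => exact ⟨fun _ => φ, rfl, fun ξ α hα => absurd hα (Nat.not_lt_zero _)⟩
  | succ n ih =>
    obtain ⟨Φ, hΦ₀, hΦ⟩ := ih (by omega)
    have hinner := fun {α β : Fin d → ℕ} (hα : order α ≤ n) (hβ : order β ≤ n) {u v : Space d} =>
      inner_weakDerivatives_eq hV hVU hk₀ hk₁ hk₂ (by omega : n ≤ r) hΦ₀ hΦ hα hβ
        (u := u) (v := v)
    have huniq : ∀ η η' : H, (∀ v ∈ U, inner ℝ η (φ v) = inner ℝ η' (φ v)) → η = η' := by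
      intro η η' h
      refine hdense.eq_of_inner_left (𝕜 := ℝ) fun w hw => ?_
      induction hw using Submodule.span_induction with
      | mem t ht =>
        obtain ⟨v, hv, rfl⟩ := ht
        exact h v hv
      | zero => simp
      | add x y _ _ hx hy => rw [inner_add_right, inner_add_right, hx, hy]
      | smul c x _ hx => rw [inner_smul_right, inner_smul_right, hx]
    -- A multi-index of order n + 1 can be reached along several coordinates. Characterizing the new
    -- vector by its inner products with all φ(v) makes it independent of the route, by `huniq`.
    let Φ' : (Fin d → ℕ) → Space d → H := fun α u =>
      if order α ≤ n then Φ α u else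
        if h : ∃ η, ∀ v ∈ U, inner ℝ η (φ v) = k α 0 u v then h.choose else 0
    have hΦ'_of_le : ∀ {α : Fin d → ℕ}, order α ≤ n → Φ' α = Φ α := by
      intro α hα
      funext u
      exact if_pos hα
    refine ⟨Φ', by rw [hΦ'_of_le (by simp), hΦ₀], fun ξ α hα i u hu => ?_⟩
    rcases Nat.lt_or_ge (order α) n with hlt | hge
    · beta_reduce
      rw [hΦ'_of_le hlt.le, hΦ'_of_le (by rw [order_add, order_single]; omega)]
      exact hΦ ξ α hlt i u hu
    have hαn : order α = n := by omega
    have hα' : order (α + Pi.single i 1) = n + 1 := by rw [order_add, order_single]; omega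
    have hsmall : ∀ᶠ h : ℝ in 𝓝[≠] 0, ∀ s ∈ Set.uIcc 0 h, u + s • coordVec i ∈ V := by
      have h1 : Tendsto (fun s : ℝ => u + s • (coordVec i : Space d)) (𝓝 0) (𝓝 u) := by
        have : Continuous fun s : ℝ => u + s • (coordVec i : Space d) := by fun_prop
        simpa using this.tendsto 0
      obtain ⟨δ, hδ, hδV⟩ := Metric.eventually_nhds_iff.1 (h1.eventually (hV.mem_nhds hu))
      refine eventually_nhdsWithin_of_eventually_nhds ?_
      filter_upwards [Metric.ball_mem_nhds (0 : ℝ) hδ] with h hh s hs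
      refine hδV ?_
      have h2 := Set.abs_sub_left_of_mem_uIcc hs
      rw [mem_ball_zero_iff, Real.norm_eq_abs] at hh
      rw [Real.dist_eq]
      rw [sub_zero] at h2 ⊢
      rw [sub_zero] at h2
      exact h2.trans_lt hh
    let q : ℝ → H := fun h => h⁻¹ • (Φ α (u + h • coordVec i) - Φ α u)
    -- The squared norm of the difference quotient is h⁻² times a mixed second difference of `k α
    -- α`, which is at most C h².
    have hqb : ∀ᶠ h in 𝓝[≠] (0 : ℝ), ‖q h‖ ≤ √(C (α + Pi.single i 1)) := by
      filter_upwards [hsmall, self_mem_nhdsWithin] with h hh hne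
      have hne' : h ≠ 0 := hne
      have hmem : ∀ s ∈ Set.uIcc 0 h, u + s • coordVec i ∈ V := hh
      have h1 := hmem h Set.right_mem_uIcc
      have h2 := abs_mixedDifference_le (f := k α α) (f₁ := k (α + Pi.single i 1) α)
        (f₁₂ := k (α + Pi.single i 1) (α + Pi.single i 1)) (u := u) (e := coordVec i) (h := h)
        (C := C (α + Pi.single i 1))
        (fun s hs t ht => hk₁ α (by omega) _ (hVU (hmem t ht)) α (by omega) i _
          (hVU (hmem s hs)))
        (fun s hs t ht => hk₂ (α + Pi.single i 1) (by omega) _ (hVU (hmem s hs)) α (by omega) i _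
          (hVU (hmem t ht)))
        (fun s hs t ht => hC _ (by omega) _ (hmem s hs) _ (hmem t ht))
      refine Real.le_sqrt_of_sq_le ?_
      have h3 : ‖q h‖ ^ 2 = (h⁻¹) ^ 2 * (k α α (u + h • coordVec i) (u + h • coordVec i)
          - k α α (u + h • coordVec i) u - k α α u (u + h • coordVec i) + k α α u u) := by
        rw [norm_smul, mul_pow, Real.norm_eq_abs, sq_abs, ← real_inner_self_eq_norm_sq,
          inner_sub_left, inner_sub_right, inner_sub_right,
          hinner hαn.le hαn.le (Or.inl h1) (Or.inl h1), hinner hαn.le hαn.le (Or.inl h1) (Or.inl hu),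
          hinner hαn.le hαn.le (Or.inl hu) (Or.inl h1), hinner hαn.le hαn.le (Or.inl hu) (Or.inl hu)]
        ring
      rw [h3]
      calc _ ≤ (h⁻¹) ^ 2 * (C (α + Pi.single i 1) * |h| ^ 2) := by
            gcongr
            exact (le_abs_self _).trans h2
        _ = C (α + Pi.single i 1) := by
            rw [sq_abs]
            field_simp
    have hqφ : ∀ v ∈ U, Tendsto (fun h => inner ℝ (q h) (φ v)) (𝓝[≠] (0 : ℝ))
        (𝓝 (k (α + Pi.single i 1) 0 u v)) := by
      intro v hv
      have h1 := hasLineDerivAt_iff_tendsto_slope_zero.1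
        (hk₁ 0 (by simp) v hv α (by omega) i u (hVU hu))
      refine h1.congr' ?_
      filter_upwards [hsmall] with h hh
      have h2 := hh h Set.right_mem_uIcc
      simp only [q]
      rw [real_inner_smul_left, inner_sub_left, smul_eq_mul]
      have h3 := hinner (β := 0) hαn.le (by simp) (Or.inl h2) (Or.inr ⟨rfl, hv⟩)
      have h4 := hinner (β := 0) hαn.le (by simp) (Or.inl hu) (Or.inr ⟨rfl, hv⟩)
      rw [hΦ₀] at h3 h4
      rw [h3, h4]
    obtain ⟨η, hη⟩ := exists_weak_limit hqb hdense (by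
      rintro _ ⟨v, hv, rfl⟩
      exact ⟨_, hqφ v hv⟩)
    have hηk : ∀ v ∈ U, inner ℝ η (φ v) = k (α + Pi.single i 1) 0 u v := fun v hv =>
      tendsto_nhds_unique (hη (φ v)) (hqφ v hv)
    have hΦη : Φ' (α + Pi.single i 1) u = η := by
      have hex : ∃ η, ∀ v ∈ U, inner ℝ η (φ v) = k (α + Pi.single i 1) 0 u v := ⟨η, hηk⟩
      simp only [Φ']
      rw [if_neg (by omega), dif_pos hex]
      exact huniq _ _ fun v hv => (hex.choose_spec v hv).trans (hηk v hv).symm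
    beta_reduce
    rw [hΦη, hΦ'_of_le hαn.le, hasLineDerivAt_iff_tendsto_slope_zero]
    refine (hη ξ).congr fun h => ?_
    simp only [q]
    rw [real_inner_smul_left, inner_sub_left, smul_eq_mul]

end WeakDerivatives

/-! ### Finitely supported functionals -/

section Pairing

variable {d : ℕ}

/-- The functional `f ↦ ∑ c_x f(x)`, as a linear function of `c`. -/
def pairing (f : Space d → ℝ) : (Space d →₀ ℝ) →ₗ[ℝ] ℝ := Finsupp.linearCombination ℝ f

lemma pairing_apply (f : Space d → ℝ) (c : Space d →₀ ℝ) :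
    pairing f c = c.sum fun x cx => cx * f x := rfl

lemma pairing_eq_sum (f : Space d → ℝ) (c : Space d →₀ ℝ) :
    pairing f c = ∑ x ∈ c.support, c x * f x := rfl

@[simp] lemma pairing_single (f : Space d → ℝ) (x : Space d) (t : ℝ) :
    pairing f (Finsupp.single x t) = t * f x := by
  simp [pairing]

lemma pairing_congr {f g : Space d → ℝ} {c : Space d →₀ ℝ} (h : ∀ x ∈ c.support, f x = g x) :
    pairing f c = pairing g c := by
  rw [pairing_eq_sum, pairing_eq_sum]
  exact Finset.sum_congr rfl fun x hx => by rw [h x hx]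

lemma pairing_add (f g : Space d → ℝ) (c : Space d →₀ ℝ) :
    pairing (fun x => f x + g x) c = pairing f c + pairing g c := by
  simp only [pairing_eq_sum, mul_add, Finset.sum_add_distrib]

lemma pairing_pairing_comm (K : Space d → Space d → ℝ) (c e : Space d →₀ ℝ) :
    pairing (fun x => pairing (K x) e) c = pairing (fun y => pairing (fun x => K x y) c) e := by
  simp only [pairing_eq_sum, Finset.mul_sum]
  rw [Finset.sum_comm]
  exact Finset.sum_congr rfl fun x _ => Finset.sum_congr rfl fun y _ => by ring

lemma isMomentFree_iff {Ω : Set (Space d)} {s : ℕ} {c : Space d →₀ ℝ} :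
    IsMomentFree Ω s c ↔ (∀ x ∈ c.support, x ∈ Ω) ∧
      ∀ p ∈ polySpace d s, pairing (polyFun p) c = 0 := Iff.rfl

/-- The bilinear form of a kernel. -/
def kernelBilin (K : Space d → Space d → ℝ) :
    (Space d →₀ ℝ) →ₗ[ℝ] (Space d →₀ ℝ) →ₗ[ℝ] ℝ :=
  Finsupp.linearCombination ℝ fun x => pairing (K x)

lemma kernelBilin_apply (K : Space d → Space d → ℝ) (c e : Space d →₀ ℝ) :
    kernelBilin K c e = pairing (fun x => pairing (K x) e) c := by
  rw [kernelBilin, Finsupp.linearCombination_apply, Finsupp.sum, LinearMap.sum_apply]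
  rfl

lemma kernelBilin_apply' (K : Space d → Space d → ℝ) (c e : Space d →₀ ℝ) :
    kernelBilin K c e = pairing (fun y => pairing (fun x => K x y) c) e := by
  rw [kernelBilin_apply, pairing_pairing_comm]

lemma kernelForm_eq (K : Space d → Space d → ℝ) (c : Space d →₀ ℝ) :
    kernelForm K c = kernelBilin K c c := by
  rw [kernelBilin_apply]
  simp only [kernelForm, pairing_eq_sum, Finsupp.sum, Finset.mul_sum, mul_assoc]

lemma kernelBilin_symm {Ω : Set (Space d)} {K : Space d → Space d → ℝ}
    (hK : ∀ x ∈ Ω, ∀ y ∈ Ω, K x y = K y x) {c e : Space d →₀ ℝ} (hc : ∀ x ∈ c.support, x ∈ Ω)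
    (he : ∀ x ∈ e.support, x ∈ Ω) : kernelBilin K c e = kernelBilin K e c := by
  rw [kernelBilin_apply, kernelBilin_apply']
  exact pairing_congr fun x hx => pairing_congr fun y hy => hK x (hc x hx) y (he y hy)

/-- The finitely supported functionals on a set that annihilate `Π^d_s`. -/
def momentFree (Ω : Set (Space d)) (s : ℕ) : Submodule ℝ (Space d →₀ ℝ) :=
  Finsupp.supported ℝ ℝ Ω ⊓ ⨅ p ∈ polySpace d s, LinearMap.ker (pairing (polyFun p))

lemma mem_momentFree {Ω : Set (Space d)} {s : ℕ} {c : Space d →₀ ℝ} :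
    c ∈ momentFree Ω s ↔ IsMomentFree Ω s c := by
  simp only [momentFree, Submodule.mem_inf, Submodule.mem_iInf, LinearMap.mem_ker,
    isMomentFree_iff]
  rfl

lemma momentFree_mono {U Ω : Set (Space d)} (h : U ⊆ Ω) (s : ℕ) :
    momentFree U s ≤ momentFree Ω s :=
  inf_le_inf_right _ (Finsupp.supported_mono h)

lemma IsCPD.kernelForm_nonneg {Ω : Set (Space d)} {s : ℕ} {K : Space d → Space d → ℝ}
    (hK : IsCPD s Ω K) {c : Space d →₀ ℝ} (hc : IsMomentFree Ω s c) : 0 ≤ kernelForm K c := by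
  rcases eq_or_ne c 0 with rfl | h
  · simp [kernelForm]
  · exact (hK.2 c hc h).le

/-! ### Polynomial reproduction -/

/-- A neighbourhood contains a product of infinite sets, and a polynomial vanishing on such a
product is zero. -/
lemma eq_zero_of_polyFun_eq_zero {V : Set (Space d)} (hV : IsOpen V) {z : Space d} (hz : z ∈ V)
    {p : MvPolynomial (Fin d) ℝ} (hp : ∀ x ∈ V, polyFun p x = 0) : p = 0 := by
  have h1 : (WithLp.toLp 2 : (Fin d → ℝ) → Space d) ⁻¹' V ∈ 𝓝 (fun i => z i) :=
    (hV.preimage (PiLp.continuous_toLp 2 _)).mem_nhds hz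
  rw [nhds_pi, Filter.mem_pi] at h1
  obtain ⟨I, -, t, ht, hsub⟩ := h1
  refine MvPolynomial.funext_set t (fun i => infinite_of_mem_nhds (z i) (ht i)) fun y hy => ?_
  rw [map_zero]
  exact hp (WithLp.toLp 2 y) (hsub fun i _ => hy i trivial)

/-- Polynomials of bounded degree are reproduced by finitely many functionals with supports in a
given open set. -/
lemma exists_polynomial_reproduction {V : Set (Space d)} (hV : IsOpen V) {z : Space d} (hz : z ∈ V)
    (s : ℕ) : ∃ (M : ℕ) (p : Fin M → MvPolynomial (Fin d) ℝ) (μ : Fin M → Space d →₀ ℝ),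
      (∀ m, p m ∈ polySpace d s) ∧ (∀ m, ∀ x ∈ (μ m).support, x ∈ V) ∧
      ∀ q ∈ polySpace d s, ∀ x, polyFun q x = ∑ m, polyFun (p m) x * pairing (polyFun q) (μ m) := by
  let b := Module.finBasis ℝ (polySpace d s)
  let ev : Space d → Module.Dual ℝ (polySpace d s) := fun x => (polyEval x).domRestrict _
  -- By finite dimensionality: no nonzero polynomial is annihilated by all evaluations on V. So each
  -- coordinate functional of the basis is a finite combination of evaluations, and these
  -- combinations are the μ_m.
  have hspan : Submodule.span ℝ (ev '' V) = ⊤ := by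
    refine Submodule.span_eq_top_of_ne_zero fun q hq => ?_
    by_contra! h
    refine hq (Subtype.ext (eq_zero_of_polyFun_eq_zero hV hz fun x hx => ?_))
    rw [← polyEval_apply]
    exact h (ev x) ⟨x, hx, rfl⟩
  have hμ : ∀ m, ∃ l ∈ Finsupp.supported ℝ ℝ V, Finsupp.linearCombination ℝ ev l = b.coord m := by
    intro m
    rw [← Finsupp.mem_span_image_iff_linearCombination, hspan]
    trivial
  choose μ hμV hμ using hμ
  refine ⟨_, fun m => (b m : MvPolynomial (Fin d) ℝ), μ, fun m => (b m).2, hμV,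
    fun q hq x => ?_⟩
  have h1 : ∀ m, pairing (polyFun q) (μ m) = b.repr ⟨q, hq⟩ m := by
    intro m
    have := LinearMap.congr_fun (hμ m) ⟨q, hq⟩
    rw [Module.Basis.coord_apply, Finsupp.linearCombination_apply, Finsupp.sum,
      LinearMap.sum_apply] at this
    rw [← this, pairing_eq_sum]
    exact Finset.sum_congr rfl fun y _ => by
      rw [← polyEval_apply]; rfl
  have h2 := congrArg (fun y : polySpace d s => polyEval x y) (b.sum_repr ⟨q, hq⟩)
  simp only [Submodule.coe_sum, Submodule.coe_smul, map_sum, map_smul, polyEval_apply,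
    smul_eq_mul] at h2
  rw [← h2]
  exact Finset.sum_congr rfl fun m _ => by rw [h1, mul_comm]

end Pairing

/-! ### Weights -/

section Weights

variable {d N : ℕ}

/-- A coefficient vector on distinct points, as a finitely supported functional. -/
def toFunctional (x : Fin N → Space d) (w : Fin N → ℝ) : Space d →₀ ℝ :=
  ∑ j, Finsupp.single (x j) (w j)

lemma pairing_toFunctional (f : Space d → ℝ) (x : Fin N → Space d) (w : Fin N → ℝ) :
    pairing f (toFunctional x w) = ∑ j, w j * f (x j) := by
  simp [toFunctional]

lemma toFunctional_eq_zero {x : Fin N → Space d} (hx : Function.Injective x) {w : Fin N → ℝ}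
    (h : toFunctional x w = 0) : w = 0 := by
  funext i
  have := congrArg (fun c => c (x i)) h
  simpa [toFunctional, Finsupp.single_apply, hx.eq_iff] using this

lemma isMomentFree_toFunctional {Ω : Set (Space d)} {x : Fin N → Space d} (hxΩ : ∀ j, x j ∈ Ω)
    {s : ℕ} {w : Fin N → ℝ} (hw : ∀ p ∈ polySpace d s, ∑ j, w j * polyFun p (x j) = 0) :
    IsMomentFree Ω s (toFunctional x w) := by
  refine ⟨fun y hy => ?_, fun p hp => ?_⟩
  · classical
    have := Finsupp.support_finsetSum hy
    simp only [Finset.mem_biUnion, Finset.mem_univ, true_and] at this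
    obtain ⟨j, hj⟩ := this
    rw [Finset.mem_singleton.1 (Finsupp.support_single_subset hj)]
    exact hxΩ j
  · rw [← pairing_apply, pairing_toFunctional, hw p hp]

lemma eq_zero_of_quadraticForm_nonpos {Ω : Set (Space d)} {s : ℕ} {K : Space d → Space d → ℝ}
    (hK : IsCPD s Ω K) {x : Fin N → Space d} (hx : Function.Injective x) (hxΩ : ∀ j, x j ∈ Ω)
    {w : Fin N → ℝ} (hw : ∀ p ∈ polySpace d s, ∑ j, w j * polyFun p (x j) = 0)
    (h : ∑ i, w i * ∑ j, w j * K (x i) (x j) ≤ 0) : w = 0 := by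
  by_contra hne
  have h1 := hK.2 _ (isMomentFree_toFunctional hxΩ hw) fun h0 => hne (toFunctional_eq_zero hx h0)
  rw [kernelForm_eq, kernelBilin_apply] at h1
  simp only [pairing_toFunctional] at h1
  exact h.not_gt h1

/-- With w = w₀ + e, where e annihilates Π_s on the nodes, the system asks that (e, v) ↦ Ae + v|_X
be onto. A vector y orthogonal to the range annihilates Π_s, so yᵀAy = 0 and positivity gives y = 0.
The polynomial v need not be unique, since X need not determine Π_s. -/
lemma exists_kernelWeights {Ω : Set (Space d)} {s k : ℕ} {K : Space d → Space d → ℝ}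
    (hK : IsCPD s Ω K) {x : Fin N → Space d} (hx : Function.Injective x) (hxΩ : ∀ j, x j ∈ Ω)
    {a : (Fin d → ℕ) → Space d → ℝ} {z : Space d} {w₀ : Fin N → ℝ}
    (hw₀ : PolyExact s k a z x w₀) : ∃ w, IsKernelWeights s k a K z x w := by
  let E : Submodule ℝ (Fin N → ℝ) :=
    { carrier := {w | ∀ p ∈ polySpace d s, ∑ j, w j * polyFun p (x j) = 0}
      add_mem' := fun {u v} hu hv p hp => by
        simp only [Pi.add_apply, add_mul, Finset.sum_add_distrib]
        rw [hu p hp, hv p hp, add_zero]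
      zero_mem' := fun p _ => by simp
      smul_mem' := fun c u hu p hp => by
        simp only [Pi.smul_apply, smul_eq_mul, mul_assoc, ← Finset.mul_sum]
        rw [hu p hp, mul_zero] }
  let A : (Fin N → ℝ) →ₗ[ℝ] (Fin N → ℝ) := Matrix.toLin' (Matrix.of fun i j => K (x i) (x j))
  have hA : ∀ w i, A w i = ∑ j, w j * K (x i) (x j) := by
    intro w i
    simp [A, Matrix.mulVec, dotProduct, mul_comm]
  let R : polySpace d s →ₗ[ℝ] (Fin N → ℝ) :=
    LinearMap.pi fun j => (polyEval (x j)).domRestrict _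
  have hR : ∀ p i, R p i = polyFun p (x i) := fun p i => polyEval_apply _ _
  let T : (E × polySpace d s) →ₗ[ℝ] (Fin N → ℝ) := (A.domRestrict E).coprod R
  have hT : LinearMap.range T = ⊤ := by
    by_contra hne
    obtain ⟨f, hf, hfT⟩ := Submodule.exists_dual_map_eq_bot_of_lt_top (lt_top_iff_ne_top.2 hne)
      inferInstance
    have hf0 : ∀ y, f (T y) = 0 := by
      intro y
      rw [← Submodule.mem_bot ℝ, ← hfT]
      exact ⟨T y, LinearMap.mem_range_self T y, rfl⟩
    set y : Fin N → ℝ := fun j => f (Pi.single j 1) with hy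
    have hfy : ∀ v : Fin N → ℝ, f v = ∑ j, y j * v j := by
      intro v
      conv_lhs => rw [pi_eq_sum_univ' v]
      rw [map_sum]
      refine Finset.sum_congr rfl fun j _ => ?_
      rw [map_smul, smul_eq_mul, mul_comm]
    have hyE : y ∈ E := by
      intro p hp
      have := hf0 (0, ⟨p, hp⟩)
      simp only [T, LinearMap.coprod_apply, map_zero, zero_add, hfy, hR] at this
      exact this
    have hy0 : y = 0 := by
      refine eq_zero_of_quadraticForm_nonpos hK hx hxΩ hyE (le_of_eq ?_)
      have := hf0 (⟨y, hyE⟩, 0)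
      simp only [T, LinearMap.coprod_apply, map_zero, add_zero, hfy, LinearMap.domRestrict_apply,
        hA] at this
      exact this
    refine hf (LinearMap.ext fun v => ?_)
    rw [hfy, hy0]
    simp
  obtain ⟨⟨e, v⟩, hev⟩ := LinearMap.range_eq_top.1 hT
    ((fun i => diffOp k a (fun u => K u (x i)) z) - A w₀)
  refine ⟨w₀ + e, ⟨v, v.2, fun i => ?_⟩, fun p hp => ?_⟩
  · have := congrFun hev i
    simp only [T, LinearMap.coprod_apply, Pi.add_apply, Pi.sub_apply, LinearMap.domRestrict_apply,
      hA, hR] at this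
    simp only [Pi.add_apply, add_mul, Finset.sum_add_distrib]
    linarith
  · simp only [Pi.add_apply, add_mul, Finset.sum_add_distrib]
    rw [hw₀ p hp, e.2 p hp, add_zero]

/-- For the difference e of two solutions, Ae consists of node values of a polynomial in Π_s, which
e annihilates; hence eᵀAe = 0. -/
lemma kernelWeights_unique {Ω : Set (Space d)} {s k : ℕ} {K : Space d → Space d → ℝ}
    (hK : IsCPD s Ω K) {x : Fin N → Space d} (hx : Function.Injective x) (hxΩ : ∀ j, x j ∈ Ω)
    {a : (Fin d → ℕ) → Space d → ℝ} {z : Space d} {w w' : Fin N → ℝ}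
    (hw : IsKernelWeights s k a K z x w) (hw' : IsKernelWeights s k a K z x w') : w' = w := by
  obtain ⟨⟨v, hv, hwv⟩, hwe⟩ := hw
  obtain ⟨⟨v', hv', hwv'⟩, hwe'⟩ := hw'
  have he : ∀ p ∈ polySpace d s, ∑ j, (w' - w) j * polyFun p (x j) = 0 := by
    intro p hp
    simp only [Pi.sub_apply, sub_mul, Finset.sum_sub_distrib]
    rw [hwe p hp, hwe' p hp, sub_self]
  refine sub_eq_zero.1 (eq_zero_of_quadraticForm_nonpos hK hx hxΩ he (le_of_eq ?_))
  have h1 : ∀ i, ∑ j, (w' - w) j * K (x i) (x j) = polyFun (v - v') (x i) := by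
    intro i
    simp only [Pi.sub_apply, sub_mul, Finset.sum_sub_distrib]
    rw [← polyEval_apply, map_sub, polyEval_apply, polyEval_apply]
    linarith [hwv i, hwv' i]
  simp only [h1]
  exact he _ (Submodule.sub_mem _ hv hv')

/-- Linear programming duality: a linear functional that is bounded by `ρ` where `N` functionals
are bounded by given numbers is a combination of these functionals of weighted `ℓ¹` norm at
most `ρ`. -/
lemma exists_weights_of_bound {W : Type*} [AddCommGroup W] [Module ℝ W]
    (ev : Fin N → W →ₗ[ℝ] ℝ) (D : W →ₗ[ℝ] ℝ) (δ : Fin N → ℝ) (hδ : ∀ j, 0 ≤ δ j) {ρ : ℝ}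
    (hρ : 0 ≤ ρ) (h : ∀ p, (∀ j, |ev j p| ≤ δ j) → D p ≤ ρ) :
    ∃ w : Fin N → ℝ, (∀ p, D p = ∑ j, w j * ev j p) ∧ ∑ j, |w j| * δ j ≤ ρ := by
  classical
  -- Functionals with δ_j = 0 (a node equal to z) impose equality constraints. They are first made
  -- to vanish; their weights are restored at the end and cost nothing in the weighted norm.
  let W' : Submodule ℝ W := ⨅ j, LinearMap.ker (if δ j = 0 then ev j else 0)
  have hW' : ∀ {p}, p ∈ W' ↔ ∀ j, δ j = 0 → ev j p = 0 := by
    intro p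
    simp only [W', Submodule.mem_iInf, LinearMap.mem_ker]
    refine forall_congr' fun j => ?_
    by_cases hj : δ j = 0 <;> simp [hj]
  let E : W' →ₗ[ℝ] (Fin N → ℝ) := LinearMap.pi fun j => (δ j)⁻¹ • (ev j).domRestrict W'
  have hE : ∀ p j, E p j = (δ j)⁻¹ * ev j p := fun _ _ => rfl
  have hle : ∀ p : W', D p ≤ ρ * ‖E p‖ := by
    intro p
    -- Scaling by t strictly above the norm also covers E p = 0. In E the convention 0⁻¹ = 0 removes
    -- the components with δ_j = 0.
    have hstep : ∀ t, ‖E p‖ < t → D p ≤ ρ * t := by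
      intro t ht
      have ht0 : 0 < t := (norm_nonneg _).trans_lt ht
      have := h (t⁻¹ • (p : W)) fun j => by
        rw [map_smul, smul_eq_mul, abs_mul, abs_of_pos (inv_pos.2 ht0)]
        rcases (hδ j).eq_or_lt with hj | hj
        · rw [hW'.1 p.2 j hj.symm, ← hj]
          simp
        · have h1 := (norm_le_pi_norm (E p) j).trans ht.le
          rw [hE, Real.norm_eq_abs, abs_mul, abs_of_pos (inv_pos.2 hj), inv_mul_le_iff₀ hj] at h1
          rw [inv_mul_le_iff₀ ht0, mul_comm]
          exact h1
      rw [map_smul, smul_eq_mul, inv_mul_le_iff₀ ht0] at this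
      linarith
    have hlim : Tendsto (fun t => ρ * t) (𝓝[>] ‖E p‖) (𝓝 (ρ * ‖E p‖)) :=
      (tendsto_id.const_mul ρ).mono_left nhdsWithin_le_nhds
    exact ge_of_tendsto hlim (eventually_nhdsWithin_of_forall fun t ht => hstep t ht)
  obtain ⟨g, hg, hgE⟩ := exists_dual_extension E (D.domRestrict W') hρ fun p => by
    refine abs_le.2 ⟨?_, hle p⟩
    have := hle (-p)
    rw [map_neg, norm_neg, Submodule.coe_neg, map_neg] at this
    rw [LinearMap.domRestrict_apply]
    linarith
  have hgsum : ∀ y, g y = ∑ j, y j * g (Pi.single j 1) := by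
    intro y
    conv_lhs => rw [pi_eq_sum_univ' y]
    rw [map_sum]
    exact Finset.sum_congr rfl fun j _ => by rw [map_smul, smul_eq_mul]
  -- The dual of the sup norm is the ℓ¹ norm: test g on the vector of signs.
  have hgl : ∑ j, |g (Pi.single j 1)| ≤ ρ := by
    have h1 : g (fun j => SignType.sign (g (Pi.single j 1))) = ∑ j, |g (Pi.single j 1)| := by
      rw [hgsum]
      exact Finset.sum_congr rfl fun j _ => sign_mul_self _
    have h2 : ‖(fun j => (SignType.sign (g (Pi.single j 1)) : ℝ) : Fin N → ℝ)‖ ≤ 1 := by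
      rw [pi_norm_le_iff_of_nonneg zero_le_one]
      intro j
      rcases lt_trichotomy (g (Pi.single j 1)) 0 with hj | hj | hj <;> simp [hj]
    rw [← h1]
    calc _ ≤ ‖g (fun j => SignType.sign (g (Pi.single j 1)))‖ := le_abs_self _
      _ ≤ ‖g‖ * 1 := g.le_opNorm_of_le h2
      _ ≤ ρ := by rwa [mul_one]
  set w₁ : Fin N → ℝ := fun j => (δ j)⁻¹ * g (Pi.single j 1) with hw₁
  -- The defect D - ∑ w₁_j ev_j vanishes on W', the common kernel of the functionals with δ_j = 0,
  -- so it is a combination of these.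
  obtain ⟨c, hc⟩ := (Submodule.mem_span_range_iff_exists_fun ℝ).1
    (mem_span_of_iInf_ker_le_ker (𝕜 := ℝ) (L := fun j => if δ j = 0 then ev j else 0)
      (K := D - ∑ j, w₁ j • ev j) fun p hp => by
        rw [LinearMap.mem_ker, LinearMap.sub_apply, LinearMap.sum_apply, sub_eq_zero]
        have h1 := hgE ⟨p, hp⟩
        rw [LinearMap.domRestrict_apply, hgsum] at h1
        rw [← h1]
        refine Finset.sum_congr rfl fun j _ => ?_
        rw [hE, LinearMap.smul_apply, smul_eq_mul, hw₁]
        ring)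
  refine ⟨fun j => w₁ j + if δ j = 0 then c j else 0, fun p => ?_, ?_⟩
  · have h1 := LinearMap.congr_fun hc p
    simp only [LinearMap.sum_apply, LinearMap.smul_apply, LinearMap.sub_apply, smul_eq_mul] at h1
    rw [eq_sub_iff_add_eq] at h1
    rw [← h1, ← Finset.sum_add_distrib]
    refine Finset.sum_congr rfl fun j _ => ?_
    by_cases hj : δ j = 0 <;> simp [hj]
    ring
  · refine le_trans (Finset.sum_le_sum fun j _ => ?_) hgl
    by_cases hj : δ j = 0
    · simp [hj]
    · simp only [hj, if_false, add_zero, hw₁]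
      rw [abs_mul, abs_inv, abs_of_nonneg (hδ j)]
      field_simp
      exact le_rfl

lemma partialD_polyFun_add (α : Fin d → ℕ) (p q : MvPolynomial (Fin d) ℝ) (z : Space d) :
    partialD α (polyFun (p + q)) z = partialD α (polyFun p) z + partialD α (polyFun q) z :=
  ((isPartialFamily_polyFun p (order α)).add (isPartialFamily_polyFun q (order α))).partialD_eqOn
    isOpen_univ (fun x _ => by simp [polyFun]) le_rfl trivial

lemma partialD_polyFun_smul (α : Fin d → ℕ) (c : ℝ) (p : MvPolynomial (Fin d) ℝ) (z : Space d) :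
    partialD α (polyFun (c • p)) z = c * partialD α (polyFun p) z :=
  ((isPartialFamily_polyFun p (order α)).const_mul c).partialD_eqOn
    isOpen_univ (fun x _ => by simp [polyFun, MvPolynomial.smul_eval]) le_rfl trivial

/-- A differential operator at a point, as a linear functional on polynomials. -/
def polyDiffOp (k : ℕ) (a : (Fin d → ℕ) → Space d → ℝ) (z : Space d) :
    MvPolynomial (Fin d) ℝ →ₗ[ℝ] ℝ where
  toFun p := diffOp k a (polyFun p) z
  map_add' p q := by
    simp only [diffOp, partialD_polyFun_add, mul_add, Finset.sum_add_distrib]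
  map_smul' c p := by
    simp only [diffOp, partialD_polyFun_smul, Finset.mul_sum, RingHom.id_apply, smul_eq_mul]
    exact Finset.sum_congr rfl fun n _ => Finset.sum_congr rfl fun α _ => by ring

/-- If the growth function is finite, then it bounds the weighted `ℓ¹` norm of the weights of some
formula that is exact for polynomials. -/
lemma exists_polyExact_of_growthFunction_ne_top {q k : ℕ} {a : (Fin d → ℕ) → Space d → ℝ}
    {z : Space d} {x : Fin N → Space d} {μ : ℝ} (h : growthFunction q k a z x μ ≠ ⊤) :
    0 ≤ (growthFunction q k a z x μ).toReal ∧ ∃ w, PolyExact q k a z x w ∧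
      ∑ j, |w j| * ‖x j - z‖ ^ μ ≤ (growthFunction q k a z x μ).toReal := by
  have hle : ∀ p ∈ polySpace d q, (∀ j, |polyFun p (x j)| ≤ ‖x j - z‖ ^ μ) →
      diffOp k a (polyFun p) z ≤ (growthFunction q k a z x μ).toReal := by
    intro p hp hpx
    have h1 : ((diffOp k a (polyFun p) z : ℝ) : EReal) ≤ growthFunction q k a z x μ :=
      le_sSup ⟨p, hp, hpx, rfl⟩
    have h2 : growthFunction q k a z x μ ≠ ⊥ := fun hb => by
      rw [hb] at h1
      exact EReal.coe_ne_bot _ (le_bot_iff.1 h1)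
    rwa [← EReal.coe_toReal h h2, EReal.coe_le_coe_iff] at h1
  have h0 : 0 ≤ (growthFunction q k a z x μ).toReal := by
    have h1 := hle 0 (Submodule.zero_mem _) fun j => by
      simp only [polyFun, map_zero, abs_zero]
      positivity
    have h2 : diffOp k a (polyFun (0 : MvPolynomial (Fin d) ℝ)) z = 0 := map_zero (polyDiffOp k a z)
    rwa [h2] at h1
  refine ⟨h0, ?_⟩
  obtain ⟨w, hw, hwρ⟩ := exists_weights_of_bound
    (fun j => (polyEval (x j)).domRestrict (polySpace d q)) ((polyDiffOp k a z).domRestrict _)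
    (fun j => ‖x j - z‖ ^ μ) (fun j => by positivity) h0
    (fun p hp => hle p p.2 fun j => by rw [← polyEval_apply]; exact hp j)
  refine ⟨w, fun p hp => ?_, hwρ⟩
  have := hw ⟨p, hp⟩
  simp only [LinearMap.domRestrict_apply, polyEval_apply] at this
  exact this.symm

end Weights

/-! ### The feature map of a conditionally positive definite kernel -/

section Projection

variable {d M : ℕ} (p : Fin M → MvPolynomial (Fin d) ℝ) (μ : Fin M → Space d →₀ ℝ)

/-- The family of partial derivatives of `f - ∑_m μ_m(f) p_m`, where `F` is that of `f`. -/
def projFamily (F : (Fin d → ℕ) → Space d → ℝ) (α : Fin d → ℕ) (u : Space d) : ℝ :=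
  F α u - ∑ m, pairing (F 0) (μ m) * partialD α (polyFun (p m)) u

/-- The functional `f ↦ f(u) - ∑_m μ_m(f) p_m(u)`. -/
def projFunctional (u : Space d) : Space d →₀ ℝ :=
  Finsupp.single u 1 - ∑ m, polyFun (p m) u • μ m

/-- The family of mixed partial derivatives of the kernel projected in both arguments. -/
def projKernel (k : (Fin d → ℕ) → (Fin d → ℕ) → Space d → Space d → ℝ) (α β : Fin d → ℕ)
    (u v : Space d) : ℝ :=
  projFamily p μ (fun β' v' => projFamily p μ (fun α' u' => k α' β' u' v') α u) β v

variable {p μ}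

lemma pairing_projFunctional (f : Space d → ℝ) (u : Space d) :
    pairing f (projFunctional p μ u) = f u - ∑ m, pairing f (μ m) * polyFun (p m) u := by
  simp [projFunctional, mul_comm]

lemma projFamily_zero (F : (Fin d → ℕ) → Space d → ℝ) (u : Space d) :
    projFamily p μ F 0 u = pairing (F 0) (projFunctional p μ u) := by
  rw [pairing_projFunctional, projFamily]
  simp only [partialD_zero]

lemma projKernel_zero (k : (Fin d → ℕ) → (Fin d → ℕ) → Space d → Space d → ℝ) (u v : Space d) :
    projKernel p μ k 0 0 u v =
      kernelBilin (k 0 0) (projFunctional p μ u) (projFunctional p μ v) := by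
  rw [projKernel, projFamily_zero, kernelBilin_apply']
  simp only [projFamily_zero]

lemma IsPartialFamily.projFamily {n : ℕ} {U : Set (Space d)} {F : (Fin d → ℕ) → Space d → ℝ}
    (hF : IsPartialFamily n F U) : IsPartialFamily n (projFamily p μ F) U :=
  hF.sub (IsPartialFamily.sum _ fun m _ =>
    ((isPartialFamily_polyFun (p m) n).mono le_rfl (Set.subset_univ _)).const_mul _)

lemma IsPartialFamily.pairing {n : ℕ} {U : Set (Space d)} {c : Space d →₀ ℝ}
    {F : Space d → (Fin d → ℕ) → Space d → ℝ} (hF : ∀ y ∈ c.support, IsPartialFamily n (F y) U) :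
    IsPartialFamily n (fun α u => pairing (fun y => F y α u) c) U := by
  simp only [pairing_eq_sum]
  exact IsPartialFamily.sum _ fun y hy => (hF y hy).const_mul _

lemma IsPartialFamily.mul_const {n : ℕ} {U : Set (Space d)} {F : (Fin d → ℕ) → Space d → ℝ}
    (hF : IsPartialFamily n F U) (c : ℝ) : IsPartialFamily n (fun α x => F α x * c) U := by
  simpa only [mul_comm] using hF.const_mul c

lemma isPartialFamily_projKernel_left {r : ℕ} {U : Set (Space d)}
    {k : (Fin d → ℕ) → (Fin d → ℕ) → Space d → Space d → ℝ}
    (hk : ∀ β, order β ≤ r → ∀ v ∈ U, IsPartialFamily r (fun α u => k α β u v) U)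
    (hμ : ∀ m, ∀ y ∈ (μ m).support, y ∈ U) {β : Fin d → ℕ} (hβ : order β ≤ r) {v : Space d}
    (hv : v ∈ U) : IsPartialFamily r (fun α u => projKernel p μ k α β u v) U :=
  (hk β hβ v hv).projFamily.sub (IsPartialFamily.sum _ fun m _ =>
    (IsPartialFamily.pairing fun y hy =>
      (hk 0 (by simp) y (hμ m y hy)).projFamily).mul_const _)

lemma isPartialFamily_projKernel_right {r : ℕ} {U : Set (Space d)}
    {k : (Fin d → ℕ) → (Fin d → ℕ) → Space d → Space d → ℝ}
    (hk : ∀ α, order α ≤ r → ∀ u ∈ U, IsPartialFamily r (fun β v => k α β u v) U)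
    (hμ : ∀ m, ∀ y ∈ (μ m).support, y ∈ U) {α : Fin d → ℕ} (hα : order α ≤ r) {u : Space d}
    (hu : u ∈ U) : IsPartialFamily r (fun β v => projKernel p μ k α β u v) U := by
  refine IsPartialFamily.projFamily (IsPartialFamily.sub (hk α hα u hu)
    (IsPartialFamily.sum _ fun m _ => IsPartialFamily.mul_const ?_ _))
  exact IsPartialFamily.pairing fun y hy => hk 0 (by simp) y (hμ m y hy)

-- The projection adds only products of polynomial derivatives with values of the kernel family at
-- support points of the μ_m. These points have to lie in V, where the bounds hold.
open Asymptotics in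
lemma exists_bound_projKernel {r : ℕ} {V : Set (Space d)} (hV : Bornology.IsBounded V)
    {k : (Fin d → ℕ) → (Fin d → ℕ) → Space d → Space d → ℝ}
    (hk : ∀ α β, order α ≤ r → order β ≤ r → ∃ C, ∀ u ∈ V, ∀ v ∈ V, |k α β u v| ≤ C)
    (hμ : ∀ m, ∀ y ∈ (μ m).support, y ∈ V) {α β : Fin d → ℕ} (hα : order α ≤ r)
    (hβ : order β ≤ r) : ∃ C, ∀ u ∈ V, ∀ v ∈ V, |projKernel p μ k α β u v| ≤ C := by
  -- Boundedness on V × V is written as O(1) along a principal filter, so that sums and products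
  -- come from the calculus of `IsBigO`.
  have key : ∀ f : Space d → Space d → ℝ, (∃ C, ∀ u ∈ V, ∀ v ∈ V, |f u v| ≤ C) ↔
      (fun w : Space d × Space d => f w.1 w.2) =O[𝓟 (V ×ˢ V)] fun _ => (1 : ℝ) := by
    intro f
    rw [isBigO_principal]
    simp only [norm_one, mul_one, Set.mem_prod, Prod.forall, Real.norm_eq_abs]
    exact ⟨fun ⟨C, hC⟩ => ⟨C, fun u v h => hC u h.1 v h.2⟩,
      fun ⟨C, hC⟩ => ⟨C, fun u hu v hv => hC u v ⟨hu, hv⟩⟩⟩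
  have hpoly : ∀ α m, ∃ C, ∀ u ∈ V, |partialD α (polyFun (p m)) u| ≤ C := by
    intro α m
    obtain ⟨C, hC⟩ := hV.isCompact_closure.exists_bound_of_continuousOn
      (continuous_partialD_polyFun (p m) α).continuousOn
    exact ⟨C, fun u hu => hC u (subset_closure hu)⟩
  have hpoly₁ : ∀ α m, (fun w : Space d × Space d => partialD α (polyFun (p m)) w.1)
      =O[𝓟 (V ×ˢ V)] fun _ => (1 : ℝ) := by
    intro α m
    obtain ⟨C, hC⟩ := hpoly α m
    exact (key fun u _ => _).1 ⟨C, fun u hu v _ => hC u hu⟩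
  have hpoly₂ : ∀ α m, (fun w : Space d × Space d => partialD α (polyFun (p m)) w.2)
      =O[𝓟 (V ×ˢ V)] fun _ => (1 : ℝ) := by
    intro α m
    obtain ⟨C, hC⟩ := hpoly α m
    exact (key fun _ v => _).1 ⟨C, fun u _ v hv => hC v hv⟩
  have hmul : ∀ {f g : Space d × Space d → ℝ}, f =O[𝓟 (V ×ˢ V)] (fun _ => (1 : ℝ)) →
      g =O[𝓟 (V ×ˢ V)] (fun _ => (1 : ℝ)) →
      (fun w => f w * g w) =O[𝓟 (V ×ˢ V)] fun _ => (1 : ℝ) := by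
    intro f g hf hg
    simpa using hf.mul hg
  have hleft : ∀ α β, order α ≤ r → order β ≤ r →
      ∃ C, ∀ u ∈ V, ∀ v ∈ V, |projFamily p μ (fun α' u' => k α' β u' v) α u| ≤ C := by
    intro α β hα hβ
    refine (key _).2 (((key _).1 (hk α β hα hβ)).sub (IsBigO.fun_sum fun m _ => hmul ?_
      (hpoly₁ α m)))
    simp only [pairing_eq_sum]
    refine IsBigO.fun_sum fun y hy => IsBigO.const_mul_left ?_ _
    obtain ⟨C, hC⟩ := hk 0 β (by simp) hβ
    exact (key fun _ v => k 0 β y v).1 ⟨C, fun u _ v hv => hC y (hμ m y hy) v hv⟩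
  refine (key _).2 (((key _).1 (hleft α β hα hβ)).sub (IsBigO.fun_sum fun m _ => hmul ?_
    (hpoly₂ β m)))
  simp only [pairing_eq_sum]
  refine IsBigO.fun_sum fun y hy => IsBigO.const_mul_left ?_ _
  obtain ⟨C, hC⟩ := hleft α 0 hα (by simp)
  exact (key fun u _ => projFamily p μ (fun α' u' => k α' 0 u' y) α u).1
    ⟨C, fun u hu v _ => hC u hu y (hμ m y hy)⟩

lemma projFunctional_mem_momentFree {U : Set (Space d)} {s : ℕ}
    (hμ : ∀ m, ∀ y ∈ (μ m).support, y ∈ U)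
    (hrep : ∀ q ∈ polySpace d s, ∀ x,
      polyFun q x = ∑ m, polyFun (p m) x * pairing (polyFun q) (μ m)) {u : Space d} (hu : u ∈ U) :
    projFunctional p μ u ∈ momentFree U s := by
  rw [momentFree, Submodule.mem_inf]
  refine ⟨Submodule.sub_mem _ (Finsupp.single_mem_supported ℝ 1 hu)
    (Submodule.sum_mem _ fun m _ => Submodule.smul_mem _ _ (hμ m)), ?_⟩
  simp only [Submodule.mem_iInf, LinearMap.mem_ker]
  intro q hq
  rw [pairing_projFunctional, hrep q hq u, sub_eq_zero]
  exact Finset.sum_congr rfl fun m _ => mul_comm _ _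

/-- Since c annihilates every p_m, the corrections ∑ c_y p_m(y) μ_m cancel. Hence the projected
evaluations span the moment-free functionals, which gives density of the span of the features. -/
lemma eq_linearCombination_projFunctional {U : Set (Space d)} {s : ℕ}
    (hp : ∀ m, p m ∈ polySpace d s) {c : Space d →₀ ℝ} (hc : c ∈ momentFree U s) :
    c = ∑ y ∈ c.support, c y • projFunctional p μ y := by
  have h1 : ∑ y ∈ c.support, c y • (∑ m, polyFun (p m) y • μ m) = 0 := by
    simp only [Finset.smul_sum]
    rw [Finset.sum_comm]
    refine Finset.sum_eq_zero fun m _ => ?_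
    simp only [smul_smul, ← Finset.sum_smul]
    rw [← pairing_eq_sum, (isMomentFree_iff.1 (mem_momentFree.1 hc)).2 _ (hp m), zero_smul]
  simp only [projFunctional, smul_sub, Finset.sum_sub_distrib]
  rw [h1, sub_zero]
  simp only [Finsupp.smul_single, smul_eq_mul, mul_one]
  exact (Finsupp.sum_single c).symm

end Projection

/-! ### Hilbert space representation of the native space -/

section Feature

variable {d : ℕ} {s : ℕ} {Ω : Set (Space d)} {K : Space d → Space d → ℝ}

/-- The bilinear form of a kernel on the functionals that annihilate `Π^d_s`. -/
def momentForm (K : Space d → Space d → ℝ) (U : Set (Space d)) (s : ℕ) :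
    momentFree U s →ₗ[ℝ] momentFree U s →ₗ[ℝ] ℝ :=
  (kernelBilin K).compl₁₂ (momentFree U s).subtype (momentFree U s).subtype

lemma momentForm_apply {U : Set (Space d)} (c e : momentFree U s) :
    momentForm K U s c e = kernelBilin K c e := rfl

lemma IsCPD.momentForm_self_nonneg (hK : IsCPD s Ω K) {U : Set (Space d)} (hU : U ⊆ Ω)
    (c : momentFree U s) : 0 ≤ momentForm K U s c c := by
  have := hK.kernelForm_nonneg (mem_momentFree.1 (momentFree_mono hU s c.2))
  rwa [kernelForm_eq] at this

lemma IsCPD.momentForm_symm (hK : IsCPD s Ω K) {U : Set (Space d)} (hU : U ⊆ Ω)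
    (c e : momentFree U s) : momentForm K U s c e = momentForm K U s e c :=
  kernelBilin_symm hK.1 (mem_momentFree.1 (momentFree_mono hU s c.2)).1
    (mem_momentFree.1 (momentFree_mono hU s e.2)).1

lemma IsCPD.abs_kernelBilin_le (hK : IsCPD s Ω K) {c e : Space d →₀ ℝ}
    (hc : IsMomentFree Ω s c) (he : IsMomentFree Ω s e) :
    |kernelBilin K c e| ≤ √(kernelForm K c) * √(kernelForm K e) := by
  have h := LinearMap.BilinForm.apply_sq_le_of_symm (M := momentFree Ω s) (momentForm K Ω s)
    (hK.momentForm_self_nonneg subset_rfl) ⟨hK.momentForm_symm subset_rfl⟩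
    ⟨c, mem_momentFree.2 hc⟩ ⟨e, mem_momentFree.2 he⟩
  simp only [momentForm_apply] at h
  rw [← kernelForm_eq, ← kernelForm_eq] at h
  rw [← Real.sqrt_mul (hK.kernelForm_nonneg hc)]
  exact Real.abs_le_sqrt h

/-- On an approximant, c kills the polynomial part and leaves the kernel form of c and the
coefficients; Cauchy-Schwarz passes to the limit. -/
lemma IsCPD.abs_pairing_le (hK : IsCPD s Ω K) {f : Space d → ℝ} {ν : ℝ}
    (hf : HasNativeNorm s Ω K f ν) {c : Space d →₀ ℝ} (hc : IsMomentFree Ω s c) :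
    |pairing f c| ≤ ν * √(kernelForm K c) := by
  obtain ⟨e, p, hep, -, hlim, hν⟩ := hf
  have h1 : Tendsto (fun n => pairing (kernelSum K (e n) (p n)) c) atTop (𝓝 (pairing f c)) := by
    simp only [pairing_eq_sum]
    exact tendsto_finsetSum _ fun x hx => (hlim x (hc.1 x hx)).const_mul _
  have h2 : ∀ n, pairing (kernelSum K (e n) (p n)) c = kernelBilin K c (e n) := by
    intro n
    have : kernelSum K (e n) (p n) = fun x => pairing (K x) (e n) + polyFun (p n) x := rfl
    rw [this, pairing_add, (isMomentFree_iff.1 hc).2 _ (hep n).2, add_zero, kernelBilin_apply]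
  simp only [h2] at h1
  rw [mul_comm]
  exact le_of_tendsto_of_tendsto' h1.abs (hν.const_mul _)
    fun n => hK.abs_kernelBilin_le hc (hep n).1

/-- The feature map of a conditionally positive definite kernel. -/
lemma IsCPD.exists_featureMap (hK : IsCPD s Ω K) {U : Set (Space d)} (hU : U ⊆ Ω) {M : ℕ}
    {p : Fin M → MvPolynomial (Fin d) ℝ} {μ : Fin M → Space d →₀ ℝ}
    (hp : ∀ m, p m ∈ polySpace d s) (hμ : ∀ m, ∀ y ∈ (μ m).support, y ∈ U)
    (hrep : ∀ q ∈ polySpace d s, ∀ x,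
      polyFun q x = ∑ m, polyFun (p m) x * pairing (polyFun q) (μ m)) :
    ∃ (H : Type) (_ : NormedAddCommGroup H) (_ : InnerProductSpace ℝ H) (_ : CompleteSpace H)
      (φ : Space d → H), Dense (Submodule.span ℝ (φ '' U) : Set H) ∧
      (∀ u ∈ U, ∀ v ∈ U, kernelBilin K (projFunctional p μ u) (projFunctional p μ v) =
        inner ℝ (φ u) (φ v)) ∧
      (∀ f ν, HasNativeNorm s Ω K f ν → ∃ ξ, ‖ξ‖ ≤ ν ∧ ∃ P ∈ polySpace d s, ∀ u ∈ U,
        f u = inner ℝ (φ u) ξ + polyFun P u) ∧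
      (∀ e, IsMomentFree U s e → ∃ P ∈ polySpace d s, ∀ u ∈ U,
        pairing (K u) e = inner ℝ (φ u) (Finsupp.linearCombination ℝ φ e) + polyFun P u) := by
  classical
  have hmono : ∀ {c}, c ∈ momentFree U s → IsMomentFree Ω s c := fun hc =>
    mem_momentFree.1 (momentFree_mono hU s hc)
  obtain ⟨H, i₁, i₂, i₃, ι, hι, hιB⟩ := exists_hilbert_completion (L := momentFree U s)
    (momentForm K U s) (hK.momentForm_symm hU) (hK.momentForm_self_nonneg hU)
  have hmem := fun {u : Space d} (hu : u ∈ U) =>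
    projFunctional_mem_momentFree (p := p) hμ hrep hu
  let lam : Space d → momentFree U s := fun u =>
    if h : u ∈ U then ⟨projFunctional p μ u, hmem h⟩ else 0
  have hlam : ∀ u ∈ U, (lam u : Space d →₀ ℝ) = projFunctional p μ u := by
    intro u hu
    simp only [lam]
    rw [dif_pos hu]
  have hsum : ∀ c : momentFree U s, ι c = Finsupp.linearCombination ℝ (fun u => ι (lam u)) c := by
    intro c
    have h1 : c = ∑ y ∈ (c : Space d →₀ ℝ).support, (c : Space d →₀ ℝ) y • lam y := by
      refine Subtype.ext ?_
      rw [Submodule.coe_sum]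
      refine (eq_linearCombination_projFunctional (μ := μ) hp c.2).trans
        (Finset.sum_congr rfl fun y hy => ?_)
      rw [Submodule.coe_smul, hlam y ((mem_momentFree.1 c.2).1 y hy)]
    conv_lhs => rw [h1]
    rw [map_sum]
    simp only [map_smul]
    rfl
  -- By definition of the projected evaluation, f differs from its values under these functionals by
  -- the polynomial ∑ μ_m(f) p_m.
  have hexp : ∀ f : Space d → ℝ, ∃ P ∈ polySpace d s, ∀ u ∈ U,
      f u = pairing f (projFunctional p μ u) + polyFun P u := by
    intro f
    refine ⟨∑ m, pairing f (μ m) • p m, Submodule.sum_mem _ fun m _ =>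
      Submodule.smul_mem _ _ (hp m), fun u _ => ?_⟩
    rw [pairing_projFunctional, ← polyEval_apply, map_sum]
    simp only [map_smul, polyEval_apply, smul_eq_mul]
    ring
  refine ⟨H, i₁, i₂, i₃, fun u => ι (lam u), ?_, ?_, ?_, ?_⟩
  · refine hι.mono ?_
    rintro _ ⟨c, rfl⟩
    rw [hsum]
    refine Submodule.sum_mem _ fun y hy => Submodule.smul_mem _ _ (Submodule.subset_span ?_)
    exact ⟨y, (mem_momentFree.1 c.2).1 y hy, rfl⟩
  · intro u hu v hv
    rw [hιB, momentForm_apply, hlam u hu, hlam v hv]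
  · intro f ν hf
    have hν : 0 ≤ ν := by
      obtain ⟨e, q, -, -, -, h⟩ := hf
      exact ge_of_tendsto' h fun n => Real.sqrt_nonneg _
    -- By `abs_pairing_le` the functional c ↦ c(f) is bounded by ν for the seminorm, so it extends
    -- to H, and Riesz gives ξ.
    obtain ⟨g, hg, hgf⟩ 
      := exists_dual_extension (W := momentFree U s) ι ((pairing f).domRestrict (momentFree U s)) hν
      fun c => by
        have h1 := hK.abs_pairing_le hf (hmono c.2)
        have h2 : ‖ι c‖ = √(kernelForm K c) := by
          rw [kernelForm_eq, ← Real.sqrt_sq (norm_nonneg (ι c)), ← real_inner_self_eq_norm_sq, hιB]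
          rfl
        rwa [h2]
    obtain ⟨P, hP, hPf⟩ := hexp f
    refine ⟨(InnerProductSpace.toDual ℝ H).symm g, by rwa [LinearIsometryEquiv.norm_map], P, hP,
      fun u hu => ?_⟩
    rw [hPf u hu, real_inner_comm, InnerProductSpace.toDual_symm_apply, hgf,
      LinearMap.domRestrict_apply, hlam u hu]
  · intro e he
    obtain ⟨P, hP, hPf⟩ := hexp fun u => pairing (K u) e
    refine ⟨P, hP, fun u hu => ?_⟩
    have h1 := hsum ⟨e, mem_momentFree.2 he⟩
    simp only at h1
    rw [hPf u hu, ← h1, hιB, momentForm_apply, hlam u hu, kernelBilin_apply]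

end Feature

/-! ### The error functional of a numerical differentiation formula -/

section ErrorFunctional

variable {d N : ℕ} {k : ℕ} {a : (Fin d → ℕ) → Space d → ℝ} {z : Space d} {x : Fin N → Space d}
  {w : Fin N → ℝ} {E : Type*} [AddCommGroup E] [Module ℝ E]

/-- The error functional `f ↦ Df(z) - ∑_j w_j f(x_j)` of a numerical differentiation formula,
applied to the family `F` of the partial derivatives of `f`. -/
def errorFunctional (k : ℕ) (a : (Fin d → ℕ) → Space d → ℝ) (z : Space d) (x : Fin N → Space d)
    (w : Fin N → ℝ) : ((Fin d → ℕ) → Space d → E) →ₗ[ℝ] E where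
  toFun F := ∑ n ∈ Finset.range (k + 1),
    ∑ α ∈ Finset.piAntidiag (Finset.univ : Finset (Fin d)) n, a α z • F α z -
      ∑ j, w j • F 0 (x j)
  map_add' F G := by
    simp only [Pi.add_apply, smul_add, Finset.sum_add_distrib]
    abel
  map_smul' c F := by
    simp only [Pi.smul_apply, RingHom.id_apply, smul_sub, Finset.smul_sum, smul_comm c]

lemma errorFunctional_apply (F : (Fin d → ℕ) → Space d → E) : errorFunctional k a z x w F =
    ∑ n ∈ Finset.range (k + 1),
      ∑ α ∈ Finset.piAntidiag (Finset.univ : Finset (Fin d)) n, a α z • F α z -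
      ∑ j, w j • F 0 (x j) := rfl

/-- This is why the values lie in an arbitrary vector space: the functional acts on the H-valued
derivatives Φ and commutes with taking inner products. -/
lemma map_errorFunctional {E' : Type*} [AddCommGroup E'] [Module ℝ E'] (L : E →ₗ[ℝ] E')
    (F : (Fin d → ℕ) → Space d → E) :
    L (errorFunctional k a z x w F) = errorFunctional k a z x w fun α u => L (F α u) := by
  simp only [errorFunctional_apply, map_sub, map_sum, map_smul]

lemma errorFunctional_congr {F G : (Fin d → ℕ) → Space d → E}
    (hz : ∀ α, order α ≤ k → F α z = G α z) (hx : ∀ j, F 0 (x j) = G 0 (x j)) :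
    errorFunctional k a z x w F = errorFunctional k a z x w G := by
  rw [errorFunctional_apply, errorFunctional_apply]
  congr 1
  · refine Finset.sum_congr rfl fun n hn => Finset.sum_congr rfl fun α hα => ?_
    rw [mem_piAntidiag_univ] at hα
    rw [Finset.mem_range] at hn
    rw [hz α (by omega)]
  · exact Finset.sum_congr rfl fun j _ => by rw [hx]

lemma errorFunctional_comm (w' : Fin N → ℝ)
    (G : (Fin d → ℕ) → (Fin d → ℕ) → Space d → Space d → ℝ) :
    errorFunctional k a z x w (fun α u => errorFunctional k a z x w' fun β v => G α β u v) =
      errorFunctional k a z x w' (fun β v => errorFunctional k a z x w fun α u => G α β u v) := by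
  rw [← map_errorFunctional (errorFunctional k a z x w') fun α u β v => G α β u v]
  congr 1
  funext β v
  let L : ((Fin d → ℕ) → Space d → ℝ) →ₗ[ℝ] ℝ :=
    { toFun := fun F => F β v
      map_add' := fun _ _ => rfl
      map_smul' := fun _ _ => rfl }
  exact map_errorFunctional L fun α u β v => G α β u v

lemma IsPartialFamily.errorFunctional_eq {n : ℕ} {F : (Fin d → ℕ) → Space d → ℝ}
    {V : Set (Space d)} (hF : IsPartialFamily n F V) (hV : IsOpen V) {f : Space d → ℝ}
    (hf : Set.EqOn f (F 0) V) (hfx : ∀ j, f (x j) = F 0 (x j)) (hk : k ≤ n) (hz : z ∈ V) :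
    errorFunctional k a z x w F = diffOp k a f z - ∑ j, w j * f (x j) := by
  rw [hF.diffOp_eq hV hf hk a hz]
  simp only [errorFunctional_apply, smul_eq_mul, hfx]

lemma PolyExact.errorFunctional_eq_zero {q : ℕ} (hw : PolyExact q k a z x w)
    {p : MvPolynomial (Fin d) ℝ} (hp : p ∈ polySpace d q) :
    errorFunctional k a z x w (fun α => partialD α (polyFun p)) = 0 := by
  rw [(isPartialFamily_polyFun p k).errorFunctional_eq isOpen_univ (f := polyFun p)
    (by simp [Set.EqOn]) (by simp) le_rfl trivial, hw p hp, sub_self]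

lemma PolyExact.mono {q q' : ℕ} (hw : PolyExact q k a z x w) (h : q' ≤ q) :
    PolyExact q' k a z x w := fun p hp => hw p (polySpace_mono h hp)

/-- The projection subtracts an element of Π_s, which an exact formula does not see; so the
projected kernel may be replaced by K itself. -/
lemma PolyExact.errorFunctional_projFamily {s M : ℕ} (hw : PolyExact s k a z x w)
    {p : Fin M → MvPolynomial (Fin d) ℝ} {μ : Fin M → Space d →₀ ℝ}
    (hp : ∀ m, p m ∈ polySpace d s) (F : (Fin d → ℕ) → Space d → ℝ) :
    errorFunctional k a z x w (projFamily p μ F) = errorFunctional k a z x w F := by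
  have h : projFamily p μ F =
      F - ∑ m, pairing (F 0) (μ m) • fun α => partialD α (polyFun (p m)) := by
    funext α u
    simp [projFamily]
  rw [h, map_sub, map_sum, Finset.sum_eq_zero, sub_zero]
  intro m _
  rw [map_smul, hw.errorFunctional_eq_zero (hp m), smul_zero]

lemma PolyExact.errorFunctional_projKernel {s M : ℕ} (hw : PolyExact s k a z x w)
    {p : Fin M → MvPolynomial (Fin d) ℝ} {μ : Fin M → Space d →₀ ℝ}
    (hp : ∀ m, p m ∈ polySpace d s)
    (G : (Fin d → ℕ) → (Fin d → ℕ) → Space d → Space d → ℝ) :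
    errorFunctional k a z x w (fun α u => errorFunctional k a z x w fun β v =>
      projKernel p μ G α β u v) =
    errorFunctional k a z x w (fun α u => errorFunctional k a z x w fun β v => G α β u v) := by
  have h1 : (fun α u => errorFunctional k a z x w (fun β v => projKernel p μ G α β u v)) =
      fun α u => errorFunctional k a z x w
        (fun β v => projFamily p μ (fun α' u' => G α' β u' v) α u) := by
    funext α u
    exact hw.errorFunctional_projFamily hp fun β v => projFamily p μ (fun α' u' => G α' β u' v) α u
  have h2 : (fun β v => errorFunctional k a z x w
        (fun α u => projFamily p μ (fun α' u' => G α' β u' v) α u)) =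
      fun β v => errorFunctional k a z x w (fun α u => G α β u v) := by
    funext β v
    exact hw.errorFunctional_projFamily hp fun α u => G α β u v
  rw [h1, errorFunctional_comm w fun α β u v => projFamily p μ (fun α' u' => G α' β u' v) α u, h2,
    errorFunctional_comm w]

/-- The error functional of a formula that is exact for polynomials only sees Taylor remainders. -/
lemma PolyExact.errorFunctional_eq_taylor {r : ℕ} (hw : PolyExact (r + 1) k a z x w) (hk : k ≤ r)
    (F : (Fin d → ℕ) → Space d → ℝ) : errorFunctional k a z x w F =
      -∑ j, w j * (F 0 (x j) - taylorSum r (x j - z) fun α => F α z) := by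
  -- After subtraction of the Taylor polynomial all derivatives at z of order at most k ≤ r vanish,
  -- and only the node values remain.
  obtain ⟨p, hp, hpz, hpx⟩ := exists_taylorPoly r z fun α => F α z
  have h1 : errorFunctional k a z x w F =
      errorFunctional k a z x w (F - fun α => partialD α (polyFun p)) := by
    rw [map_sub, hw.errorFunctional_eq_zero hp, sub_zero]
  rw [h1, errorFunctional_apply, Finset.sum_eq_zero, zero_sub]
  · simp [hpx]
  · intro n hn
    refine Finset.sum_eq_zero fun α hα => ?_
    rw [mem_piAntidiag_univ] at hα
    rw [Finset.mem_range] at hn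
    simp [hpz α (by omega)]

/-- The Taylor reduction in the second and then the first argument; the two minus signs cancel. -/
lemma PolyExact.errorFunctional_errorFunctional_eq {r : ℕ} (hw : PolyExact (r + 1) k a z x w)
    (hk : k ≤ r) (G : (Fin d → ℕ) → (Fin d → ℕ) → Space d → Space d → ℝ) :
    errorFunctional k a z x w (fun α u => errorFunctional k a z x w fun β v => G α β u v) =
      ∑ j, ∑ i, w j * w i * (
        (G 0 0 (x i) (x j) - taylorSum r (x j - z) fun β => G 0 β (x i) z) -
        taylorSum r (x i - z) fun α =>
          G α 0 z (x j) - taylorSum r (x j - z) fun β => G α β z z) := by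
  have h1 : (fun α u => errorFunctional k a z x w fun β v => G α β u v) =
      -∑ j, w j • fun α u => G α 0 u (x j) - taylorSum r (x j - z) fun β => G α β u z := by
    funext α u
    rw [hw.errorFunctional_eq_taylor hk]
    simp
  rw [h1, map_neg, map_sum, ← Finset.sum_neg_distrib]
  refine Finset.sum_congr rfl fun j _ => ?_
  rw [map_smul, hw.errorFunctional_eq_taylor hk, smul_eq_mul, mul_neg, neg_neg, Finset.mul_sum]
  exact Finset.sum_congr rfl fun i _ => by ring

end ErrorFunctional

/-! ### Hölder seminorms -/

section Holder

variable {d N : ℕ} {z : Space d} {x : Fin N → Space d} {γ : ℝ}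

/-- At u = z or v = z both sides are zero, because γ > 0; excluding z from the supremum loses
nothing. -/
lemma abs_mixed_le_of_mixedHolder_ne_top (hγ : 0 < γ) {G : Space d → Space d → ℝ}
    (hG : mixedHolder z x γ G ≠ ⊤) {u v : Space d} (hu : u ∈ starSet z x) (hv : v ∈ starSet z x) :
    |G u v - G u z - G z v + G z z| ≤
      (mixedHolder z x γ G).toReal * (‖u - z‖ ^ γ * ‖v - z‖ ^ γ) := by
  rcases eq_or_ne u z with rfl | huz
  · simp [Real.zero_rpow hγ.ne']
  rcases eq_or_ne v z with rfl | hvz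
  · simp [Real.zero_rpow hγ.ne']
  have h1 : 0 < ‖u - z‖ ^ γ * ‖v - z‖ ^ γ := by
    have := norm_pos_iff.2 (sub_ne_zero.2 huz)
    have := norm_pos_iff.2 (sub_ne_zero.2 hvz)
    positivity
  rw [← div_le_iff₀ h1, ← ENNReal.ofReal_le_iff_le_toReal hG]
  exact le_iSup₂_of_le (f := fun u _ => ⨆ v ∈ starSet z x \ {z},
    ENNReal.ofReal (|G u v - G u z - G z v + G z z| / (‖u - z‖ ^ γ * ‖v - z‖ ^ γ))) u ⟨hu, huz⟩
    (le_iSup₂_of_le (f := fun v _ => ENNReal.ofReal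
      (|G u v - G u z - G z v + G z z| / (‖u - z‖ ^ γ * ‖v - z‖ ^ γ))) v ⟨hv, hvz⟩ le_rfl)

lemma kernelHolder_toReal (hγ : 0 < γ) {r : ℕ} {K : Space d → Space d → ℝ}
    (h : kernelHolder z x r γ K ≠ ⊤) :
    (∀ α β, order α = r → order β = r → mixedHolder z x γ (kernelPartial α β K) ≠ ⊤) ∧
    (kernelHolder z x r γ K).toReal = (1 / ∏ j ∈ Finset.Icc 1 r, (γ + j) ^ 2) *
      √(∑ α ∈ Finset.piAntidiag (Finset.univ : Finset (Fin d)) r,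
        ∑ β ∈ Finset.piAntidiag (Finset.univ : Finset (Fin d)) r,
          (Nat.multinomial Finset.univ α : ℝ) * (Nat.multinomial Finset.univ β : ℝ) *
            (mixedHolder z x γ (kernelPartial α β K)).toReal ^ 2) := by
  have hP : 0 < 1 / ∏ j ∈ Finset.Icc 1 r, (γ + (j : ℝ)) ^ 2 :=
    one_div_pos.2 (Finset.prod_pos fun j _ => by positivity)
  rw [kernelHolder] at h ⊢
  set S : ℝ≥0∞ := ∑ α ∈ Finset.piAntidiag (Finset.univ : Finset (Fin d)) r,
      ∑ β ∈ Finset.piAntidiag (Finset.univ : Finset (Fin d)) r,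
        (Nat.multinomial Finset.univ α : ℝ≥0∞) * (Nat.multinomial Finset.univ β : ℝ≥0∞) *
          mixedHolder z x γ (kernelPartial α β K) ^ 2 with hS
  have hS_top : S ≠ ⊤ := by
    -- The prefactor is positive, so an infinite sum would make the whole seminorm infinite. The
    -- multinomial weights are positive too, so each Hölder constant is finite.
    intro hS'
    rw [hS', ENNReal.top_rpow_of_pos (by norm_num), ENNReal.mul_top] at h
    · exact h rfl
    · exact (ENNReal.ofReal_pos.2 hP).ne'
  have hterm : ∀ α ∈ Finset.piAntidiag (Finset.univ : Finset (Fin d)) r,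
      ∀ β ∈ Finset.piAntidiag (Finset.univ : Finset (Fin d)) r,
        (Nat.multinomial Finset.univ α : ℝ≥0∞) * (Nat.multinomial Finset.univ β : ℝ≥0∞) *
          mixedHolder z x γ (kernelPartial α β K) ^ 2 ≠ ⊤ := by
    intro α hα β hβ
    exact ENNReal.sum_ne_top.1 (ENNReal.sum_ne_top.1 hS_top α hα) β hβ
  refine ⟨fun α β hα hβ hm => ?_, ?_⟩
  · refine hterm α (mem_piAntidiag_univ.2 hα) β (mem_piAntidiag_univ.2 hβ) ?_
    rw [hm, ENNReal.top_pow two_ne_zero, ENNReal.mul_top]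
    have h1 := Nat.multinomial_pos (Finset.univ : Finset (Fin d)) α
    have h2 := Nat.multinomial_pos (Finset.univ : Finset (Fin d)) β
    exact mul_ne_zero (Nat.cast_ne_zero.2 h1.ne') (Nat.cast_ne_zero.2 h2.ne')
  · rw [ENNReal.toReal_mul, ENNReal.toReal_ofReal hP.le, ← ENNReal.toReal_rpow,
      ← Real.sqrt_eq_rpow]
    congr 2
    rw [hS, ENNReal.toReal_sum fun α hα => ENNReal.sum_ne_top.2 (hterm α hα)]
    refine Finset.sum_congr rfl fun α hα => ?_
    rw [ENNReal.toReal_sum (hterm α hα)]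
    refine Finset.sum_congr rfl fun β _ => ?_
    rw [ENNReal.toReal_mul, ENNReal.toReal_mul, ENNReal.toReal_pow, ENNReal.toReal_natCast,
      ENNReal.toReal_natCast]

lemma mem_starSet_add_smul (i : Fin N) {t : ℝ} (ht : t ∈ Set.Icc (0 : ℝ) 1) :
    z + t • (x i - z) ∈ starSet z x := by
  refine Set.mem_iUnion.2 ⟨i, ?_⟩
  rw [segment_eq_image']
  exact ⟨t, ht, rfl⟩

/-- The remainder of the Taylor expansion in both variables of a function with the family `G` of
mixed partial derivatives. -/
lemma abs_taylor_remainder_le_of_mixedHolder (hγ : 0 < γ) {r : ℕ}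
    {G : (Fin d → ℕ) → (Fin d → ℕ) → Space d → Space d → ℝ} {U : Set (Space d)} (hU : IsOpen U)
    (hSU : starSet z x ⊆ U)
    (h₁ : ∀ β, order β ≤ r → ∀ v ∈ U, IsPartialFamily r (fun α u => G α β u v) U)
    (h₂ : ∀ α, order α ≤ r → ∀ u ∈ U, IsPartialFamily r (fun β v => G α β u v) U)
    (hcont : ∀ α β, order α ≤ r → order β ≤ r → ∀ u ∈ starSet z x, ∀ v ∈ starSet z x,
      ContinuousAt (fun y : Space d × Space d => G α β y.1 y.2) (u, v))
    (htop : ∀ α β, order α = r → order β = r → mixedHolder z x γ (G α β) ≠ ⊤) (i j : Fin N) :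
    |(G 0 0 (x i) (x j) - taylorSum r (x j - z) fun β => G 0 β (x i) z) -
      taylorSum r (x i - z) fun α => G α 0 z (x j) - taylorSum r (x j - z) fun β => G α β z z| ≤
      ‖x i - z‖ ^ (r + γ) * ‖x j - z‖ ^ (r + γ) * ((1 / ∏ j ∈ Finset.Icc 1 r, (γ + j) ^ 2) *
      √(∑ α ∈ Finset.piAntidiag (Finset.univ : Finset (Fin d)) r,
        ∑ β ∈ Finset.piAntidiag (Finset.univ : Finset (Fin d)) r,
          (Nat.multinomial Finset.univ α : ℝ) * (Nat.multinomial Finset.univ β : ℝ) *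
            (mixedHolder z x γ (G α β)).toReal ^ 2)) := by
  have h := abs_taylor_remainder_le (r := r) hγ (x i - z) (x j - z)
    (fun α β t τ => G α β (z + t • (x i - z)) (z + τ • (x j - z)))
    (fun α β => (mixedHolder z x γ (G α β)).toReal) ?_ ?_ ?_
  · simpa only [one_smul, zero_smul, add_zero, add_sub_cancel] using h
  · intro α β hα hβ t ht τ hτ
    have hu := mem_starSet_add_smul (z := z) (x := x) i ht
    have hv := mem_starSet_add_smul (z := z) (x := x) j hτ
    -- Segments need not be parallel to the axes; continuity of the coordinate partials at points of
    -- the star gives the derivative along them.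
    refine (hasLineDerivAt_of_continuousAt_partials
      (f := fun u => G α β u (z + τ • (x j - z)))
      (g := fun l u => G (α + Pi.single l 1) β u (z + τ • (x j - z)))
      ?_ (fun l => ?_) (x i - z)).hasDerivAt_add_smul
    · filter_upwards [hU.mem_nhds (hSU hu)] with u hu' l
      exact h₁ β hβ _ (hSU hv) α hα l u hu'
    · exact ContinuousAt.comp (f := fun u => (u, z + τ • (x j - z)))
        (hcont (α + Pi.single l 1) β (by rw [order_add, order_single]; omega) hβ _ hu _ hv)
        (by fun_prop)
  · intro α β hα hβ t ht τ hτ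
    have hu := mem_starSet_add_smul (z := z) (x := x) i ht
    have hv := mem_starSet_add_smul (z := z) (x := x) j hτ
    refine (hasLineDerivAt_of_continuousAt_partials
      (f := fun v => G α β (z + t • (x i - z)) v)
      (g := fun l v => G α (β + Pi.single l 1) (z + t • (x i - z)) v)
      ?_ (fun l => ?_) (x j - z)).hasDerivAt_add_smul
    · filter_upwards [hU.mem_nhds (hSU hv)] with v hv' l
      exact h₂ α hα _ (hSU hu) β hβ l v hv'
    · exact ContinuousAt.comp (f := fun v => (z + t • (x i - z), v))
        (hcont α (β + Pi.single l 1) hα (by rw [order_add, order_single]; omega) _ hu _ hv)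
        (by fun_prop)
  · intro α β hα hβ t ht τ hτ
    have h1 := abs_mixed_le_of_mixedHolder_ne_top hγ (htop α β hα hβ)
      (mem_starSet_add_smul (z := z) (x := x) i ht) (mem_starSet_add_smul (z := z) (x := x) j hτ)
    simpa only [zero_smul, add_zero, add_sub_cancel_left, norm_smul, Real.norm_eq_abs,
      abs_of_nonneg ht.1, abs_of_nonneg hτ.1] using h1

end Holder

/-! ### The error bound -/

section ErrorBound

variable {d N : ℕ} {s k r : ℕ} {a : (Fin d → ℕ) → Space d → ℝ} {z : Space d}
  {x : Fin N → Space d} {w : Fin N → ℝ} {Ω U : Set (Space d)} {K : Space d → Space d → ℝ}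
  {G : (Fin d → ℕ) → (Fin d → ℕ) → Space d → Space d → ℝ}

/-- Continuity is given only at (z, z). As there are finitely many multi-indices of order at most r,
one neighbourhood serves them all. -/
lemma exists_open_bound {U : Set (Space d)} (hU : IsOpen U) (hz : z ∈ U)
    (hcont : ∀ α β, order α ≤ r → order β ≤ r →
      ContinuousAt (fun y : Space d × Space d => G α β y.1 y.2) (z, z)) :
    ∃ V, IsOpen V ∧ z ∈ V ∧ V ⊆ U ∧ Bornology.IsBounded V ∧
      ∀ α β, order α ≤ r → order β ≤ r → ∃ C, ∀ u ∈ V, ∀ v ∈ V, |G α β u v| ≤ C := by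
  have h1 : ∀ᶠ y : Space d × Space d in 𝓝 (z, z), ∀ α ∈ {α : Fin d → ℕ | order α ≤ r},
      ∀ β ∈ {β : Fin d → ℕ | order β ≤ r}, |G α β y.1 y.2| < |G α β z z| + 1 := by
    rw [Filter.eventually_all_finite (finite_order_le r)]
    intro α hα
    rw [Filter.eventually_all_finite (finite_order_le r)]
    intro β hβ
    exact (hcont α β hα hβ).abs.eventually_lt continuousAt_const (lt_add_one _)
  obtain ⟨δ, hδ, hball⟩ := Metric.eventually_nhds_iff.1 h1
  refine ⟨Metric.ball z δ ∩ U, Metric.isOpen_ball.inter hU, ⟨Metric.mem_ball_self hδ, hz⟩,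
    Set.inter_subset_right, Metric.isBounded_ball.subset Set.inter_subset_left,
    fun α β hα hβ => ⟨|G α β z z| + 1, fun u hu v hv => (hball (y := (u, v)) ?_ α hα β hβ).le⟩⟩
  rw [Prod.dist_eq]
  exact max_lt hu.1 hv.1

/-- The functions in the native space have partial derivatives near `z`, and the error of the
kernel-based formula is bounded by the power function of any formula that is exact for `Π^d_s`. -/
lemma IsCPD.exists_error_bound (hK : IsCPD s Ω K) (hU : IsOpen U) (hUΩ : U ⊆ Ω) (hz : z ∈ U)
    (hxU : ∀ j, x j ∈ U) (hG₀ : G 0 0 = K)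
    (h₁ : ∀ β, order β ≤ r → ∀ v ∈ U, IsPartialFamily r (fun α u => G α β u v) U)
    (h₂ : ∀ α, order α ≤ r → ∀ u ∈ U, IsPartialFamily r (fun β v => G α β u v) U)
    (hcont : ∀ α β, order α ≤ r → order β ≤ r →
      ContinuousAt (fun y : Space d × Space d => G α β y.1 y.2) (z, z))
    (hkr : k ≤ r) (hw : IsKernelWeights s k a K z x w) :
    ∃ V, IsOpen V ∧ z ∈ V ∧ V ⊆ U ∧ ∀ f ν, HasNativeNorm s Ω K f ν →
      HasPartialsOn r f V ∧ ∀ w', PolyExact s k a z x w' →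
        |diffOp k a f z - ∑ j, w j * f (x j)| ≤ ν * √(errorFunctional k a z x w' fun α u =>
          errorFunctional k a z x w' fun β v => G α β u v) := by
  obtain ⟨V, hV, hzV, hVU, hVb, hbound⟩ := exists_open_bound hU hz hcont
  obtain ⟨M, p, μ, hp, hμV, hrep⟩ := exists_polynomial_reproduction hV hzV s
  have hμ : ∀ m, ∀ y ∈ (μ m).support, y ∈ U := fun m y hy => hVU (hμV m y hy)
  obtain ⟨H, _, _, _, φ, hdense, hφ, hnative, hsection⟩ := hK.exists_featureMap hUΩ hp hμ hrep
  have hk₀ : ∀ u ∈ U, ∀ v ∈ U, projKernel p μ G 0 0 u v = inner ℝ (φ u) (φ v) := by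
    intro u hu v hv
    rw [projKernel_zero, hG₀, hφ u hu v hv]
  have hk₁ := fun β (hβ : order β ≤ r) v (hv : v ∈ U) =>
    isPartialFamily_projKernel_left (p := p) h₁ hμ hβ hv
  have hk₂ := fun α (hα : order α ≤ r) u (hu : u ∈ U) =>
    isPartialFamily_projKernel_right (p := p) h₂ hμ hα hu
  have hC : ∀ α, ∃ C, order α ≤ r → ∀ u ∈ V, ∀ v ∈ V, |projKernel p μ G α α u v| ≤ C := by
    intro α
    by_cases hα : order α ≤ r
    · obtain ⟨C, hC⟩ := exists_bound_projKernel (p := p) hVb hbound hμV hα hα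
      exact ⟨C, fun _ => hC⟩
    · exact ⟨0, fun h => absurd h hα⟩
  choose C hC using hC
  obtain ⟨Φ, hΦ₀, hΦ⟩ := exists_weakDerivatives hV hVU hdense hk₀ hk₁ hk₂ hC le_rfl
  set Λ : (Fin N → ℝ) → H := fun w => errorFunctional k a z x w Φ with hΛ
  have hΛ_inner : ∀ w ξ, inner ℝ (Λ w) ξ =
      errorFunctional k a z x w fun α u => inner ℝ (Φ α u) ξ := by
    intro w ξ
    let L : H →ₗ[ℝ] ℝ :=
      { toFun := fun y => inner ℝ y ξ
        map_add' := fun _ _ => inner_add_left _ _ _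
        map_smul' := fun _ _ => real_inner_smul_left _ _ _ }
    exact map_errorFunctional L Φ
  have hrepr : ∀ (f : Space d → ℝ) (ξ : H), (∃ P ∈ polySpace d s, ∀ u ∈ U,
      f u = inner ℝ (φ u) ξ + polyFun P u) → HasPartialsOn r f V ∧
      ∀ w, PolyExact s k a z x w → diffOp k a f z - ∑ j, w j * f (x j) = inner ℝ (Λ w) ξ := by
    rintro f ξ ⟨P, hP, hf⟩
    have hF := (hΦ ξ).add ((isPartialFamily_polyFun P r).mono le_rfl (Set.subset_univ V))
    have hfU : ∀ u ∈ U, f u = inner ℝ (Φ 0 u) ξ + partialD 0 (polyFun P) u := by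
      intro u hu
      rw [hΦ₀, partialD_zero, hf u hu]
    refine ⟨hF.hasPartialsOn hV fun u hu => hfU u (hVU hu), fun w hw => ?_⟩
    rw [← hF.errorFunctional_eq hV (fun u hu => hfU u (hVU hu)) (fun j => hfU _ (hxU j)) hkr hzV,
      hΛ_inner]
    have := map_add (errorFunctional k a z x w) (fun α u => inner ℝ (Φ α u) ξ)
      (fun α => partialD α (polyFun P))
    rw [hw.errorFunctional_eq_zero hP, add_zero] at this
    exact this
  -- The difference Λ w' - Λ w is the feature image of the moment-free functional e with weights w -
  -- w' on X. Pairing it with Λ w gives the formula's error on ∑ e_j K(·, x_j), which the defining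
  -- system turns into ∑ e_j v(x_j) = 0.
  have horth : ∀ w', PolyExact s k a z x w' → inner ℝ (Λ w) (Λ w' - Λ w) = 0 := by
    intro w' hw'
    have he : ∀ q ∈ polySpace d s, ∑ j, (w - w') j * polyFun q (x j) = 0 := by
      intro q hq
      simp only [Pi.sub_apply, sub_mul, Finset.sum_sub_distrib]
      rw [hw.2 q hq, hw' q hq, sub_self]
    have h3 := hsection _ (isMomentFree_toFunctional hxU he)
    have h4 : Λ w' - Λ w = Finsupp.linearCombination ℝ φ (toFunctional x (w - w')) := by
      simp only [hΛ, errorFunctional_apply, toFunctional, map_sum, Finsupp.linearCombination_single,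
        Pi.sub_apply, sub_smul, Finset.sum_sub_distrib, hΦ₀]
      abel
    rw [h4, ← (hrepr _ _ h3).2 w hw.2]
    simp only [pairing_toFunctional]
    obtain ⟨v, hv, hwv⟩ := hw.1
    have hfam : IsPartialFamily r (fun α u => ∑ j, (w - w') j * G α 0 u (x j)) U :=
      IsPartialFamily.sum _ fun j _ => (h₁ 0 (by simp) (x j) (hxU j)).const_mul _
    have hD : diffOp k a (fun u => ∑ j, (w - w') j * K u (x j)) z =
        ∑ j, (w - w') j * diffOp k a (fun u => K u (x j)) z := by
      rw [hfam.diffOp_eq hU (fun u _ => by rw [hG₀]) hkr a hz]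
      have hsec : ∀ j, diffOp k a (fun u => K u (x j)) z = ∑ n ∈ Finset.range (k + 1),
          ∑ α ∈ Finset.piAntidiag (Finset.univ : Finset (Fin d)) n, a α z * G α 0 z (x j) :=
        fun j => (h₁ 0 (by simp) (x j) (hxU j)).diffOp_eq hU (fun u _ => by rw [hG₀]) hkr a hz
      simp only [hsec, Finset.mul_sum]
      symm
      rw [Finset.sum_comm]
      refine Finset.sum_congr rfl fun n _ => ?_
      rw [Finset.sum_comm]
      exact Finset.sum_congr rfl fun α _ => Finset.sum_congr rfl fun j _ => by ring
    rw [hD]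
    have h5 : ∑ i, w i * ∑ j, (w - w') j * K (x i) (x j) =
        ∑ j, (w - w') j * ∑ i, w i * K (x j) (x i) := by
      simp only [Finset.mul_sum]
      rw [Finset.sum_comm]
      refine Finset.sum_congr rfl fun j _ => Finset.sum_congr rfl fun i _ => ?_
      rw [hK.1 _ (hUΩ (hxU i)) _ (hUΩ (hxU j))]
      ring
    rw [h5, ← Finset.sum_sub_distrib, ← he v hv]
    refine Finset.sum_congr rfl fun j _ => ?_
    rw [← hwv j]
    ring
  refine ⟨V, hV, hzV, hVU, fun f ν hf => ?_⟩
  obtain ⟨ξ, hξ, hfξ⟩ := hnative f ν hf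
  refine ⟨(hrepr f ξ hfξ).1, fun w' hw' => ?_⟩
  rw [(hrepr f ξ hfξ).2 w hw.2]
  -- Derivatives of positive order are needed only at z ∈ V, while at the nodes in U only values
  -- enter; this is the admissibility condition in `hadm`.
  have hnorm : ‖Λ w'‖ ^ 2 = errorFunctional k a z x w' fun α u =>
      errorFunctional k a z x w' fun β v => G α β u v := by
    have hadm : ∀ α β, order α ≤ k → order β ≤ k → ∀ u v, (u ∈ V ∨ (α = 0 ∧ u ∈ U)) →
        (v ∈ V ∨ (β = 0 ∧ v ∈ U)) → inner ℝ (Φ α u) (Φ β v) = projKernel p μ G α β u v :=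
      fun α β hα hβ u v hu hv => inner_weakDerivatives_eq hV hVU hk₀ hk₁ hk₂ le_rfl hΦ₀ hΦ
        (hα.trans hkr) (hβ.trans hkr) hu hv
    have h6 : ∀ α u, order α ≤ k → (u ∈ V ∨ (α = 0 ∧ u ∈ U)) → inner ℝ (Φ α u) (Λ w') =
        errorFunctional k a z x w' fun β v => projKernel p μ G α β u v := by
      intro α u hα hu
      rw [real_inner_comm, hΛ_inner]
      refine errorFunctional_congr (fun β hβ => ?_) fun j => ?_
      · rw [real_inner_comm]
        exact hadm α β hα hβ u z hu (Or.inl hzV)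
      · rw [real_inner_comm]
        exact hadm α 0 hα (by simp) u (x j) hu (Or.inr ⟨rfl, hxU j⟩)
    rw [← real_inner_self_eq_norm_sq, hΛ_inner, ← hw'.errorFunctional_projKernel (μ := μ) hp]
    exact errorFunctional_congr (fun α hα => h6 α z hα (Or.inl hzV))
      fun j => h6 0 (x j) (by simp) (Or.inr ⟨rfl, hxU j⟩)
  rw [← hnorm, Real.sqrt_sq (norm_nonneg _)]
  -- Pythagoras: the kernel weights minimize the norm among all weights exact on Π_s.
  have hmin : ‖Λ w‖ ≤ ‖Λ w'‖ := by
    have h7 := horth w' hw'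
    have h8 : ‖Λ w'‖ ^ 2 = ‖Λ w‖ ^ 2 + ‖Λ w' - Λ w‖ ^ 2 := by
      have := norm_add_sq_real (Λ w) (Λ w' - Λ w)
      rw [h7, add_sub_cancel] at this
      linarith
    refine le_of_sq_le_sq ?_ (norm_nonneg _)
    rw [h8]
    exact le_add_of_nonneg_right (sq_nonneg _)
  calc |inner ℝ (Λ w) ξ| ≤ ‖Λ w‖ * ‖ξ‖ := abs_real_inner_le_norm _ _
    _ ≤ ‖Λ w'‖ * ν := by gcongr
    _ = ν * ‖Λ w'‖ := mul_comm _ _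

end ErrorBound

end KernelDiff

end

open KernelDiff in
theorem theorem1 {d N : ℕ} (s k r : ℕ) (γ : ℝ)
    (Ω : Set (KernelDiff.Space d))
    (K : KernelDiff.Space d → KernelDiff.Space d → ℝ)
    (a : (Fin d → ℕ) → KernelDiff.Space d → ℝ)
    (z : KernelDiff.Space d) (x : Fin N → KernelDiff.Space d)
    (hN : 0 < N) (hx : Function.Injective x)
    (hK : KernelDiff.IsCPD s Ω K)
    (hS : KernelDiff.starSet z x ⊆ Ω)
    (hcons : ∃ w : Fin N → ℝ, KernelDiff.PolyExact s k a z x w)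
    (hkr : k ≤ r) (hγ0 : 0 < γ) (hγ1 : γ ≤ 1)
    (hsmooth : KernelDiff.HasContKernelPartials r K Ω (KernelDiff.starSet z x))
    (hfin : KernelDiff.kernelHolder z x r γ K ≠ ⊤) :
    ∃ w : Fin N → ℝ,
      KernelDiff.IsKernelWeights s k a K z x w ∧
      (∀ w' : Fin N → ℝ, KernelDiff.IsKernelWeights s k a K z x w' → w' = w) ∧
      ∀ f : KernelDiff.Space d → ℝ, KernelDiff.InNativeSpace s Ω K f →
        (∃ V : Set (KernelDiff.Space d), IsOpen V ∧ z ∈ V ∧ V ⊆ Ω ∧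
          KernelDiff.HasPartialsOn k f V) ∧
        -- for an infinite growth function the bound is void
        (KernelDiff.growthFunction (max s (r + 1)) k a z x (r + γ) ≠ ⊤ →
          |KernelDiff.diffOp k a f z - ∑ j, w j * f (x j)| ≤
            (KernelDiff.growthFunction (max s (r + 1)) k a z x (r + γ)).toReal *
              √(KernelDiff.kernelHolder z x r γ K).toReal *
              KernelDiff.nativeNorm s Ω K f) := by
  have hzS : z ∈ starSet z x := Set.mem_iUnion.2 ⟨⟨0, hN⟩, left_mem_segment ℝ _ _⟩
  have hxS : ∀ j, x j ∈ starSet z x := fun j => Set.mem_iUnion.2 ⟨j, right_mem_segment ℝ _ _⟩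
  obtain ⟨w₀, hw₀⟩ := hcons
  obtain ⟨w, hw⟩ := exists_kernelWeights hK hx (fun j => hS (hxS j)) hw₀
  refine ⟨w, hw, fun w' hw' => kernelWeights_unique hK hx (fun j => hS (hxS j)) hw hw', ?_⟩
  obtain ⟨U, hU, hSU, hUΩ, hKP⟩ := hsmooth
  have h₁ : ∀ β, order β ≤ r → ∀ v ∈ U,
      IsPartialFamily r (fun α u => kernelPartial α β K u v) U :=
    fun β hβ v hv α hα i u hu => (hKP α β hα.le hβ).1 hα i u hu v hv
  have h₂ : ∀ α, order α ≤ r → ∀ u ∈ U,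
      IsPartialFamily r (fun β v => kernelPartial α β K u v) U :=
    fun α hα u hu β hβ i v hv => (hKP α β hα hβ.le).2.1 hβ i u hu v hv
  have hcont : ∀ α β, order α ≤ r → order β ≤ r → ∀ u ∈ starSet z x, ∀ v ∈ starSet z x,
      ContinuousAt (fun y : Space d × Space d => kernelPartial α β K y.1 y.2) (u, v) :=
    fun α β hα hβ => (hKP α β hα hβ).2.2
  obtain ⟨V, hV, hzV, hVU, hmain⟩ := hK.exists_error_bound hU hUΩ (hSU hzS)
    (fun j => hSU (hxS j)) (G := fun α β => kernelPartial α β K)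
    (by funext u v; simp [kernelPartial]) h₁ h₂
    (fun α β hα hβ => hcont α β hα hβ z hzS z hzS) hkr hw
  rintro f ⟨ν₀, hν₀⟩
  refine ⟨⟨V, hV, hzV, hVU.trans hUΩ, fun α hα => (hmain f ν₀ hν₀).1 α (hα.trans_le hkr)⟩,
    fun hρ => ?_⟩
  -- The competitor is exact on Π_q with q = max(s, r+1): order s makes it admissible in the
  -- comparison of norms, order r+1 removes the Taylor polynomials.
  obtain ⟨hρ0, w', hw', hw'ρ⟩ := exists_polyExact_of_growthFunction_ne_top hρ
  set ρ := (growthFunction (max s (r + 1)) k a z x (r + γ)).toReal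
  set κ := (kernelHolder z x r γ K).toReal with hκ
  have hκ0 : 0 ≤ κ := ENNReal.toReal_nonneg
  obtain ⟨htop, heq⟩ := kernelHolder_toReal hγ0 hfin
  have hquad : errorFunctional k a z x w' (fun α u =>
      errorFunctional k a z x w' fun β v => kernelPartial α β K u v) ≤ κ * ρ ^ 2 := by
    rw [(hw'.mono (le_max_right s (r + 1))).errorFunctional_errorFunctional_eq hkr]
    have hR : ∀ i j, |(kernelPartial 0 0 K (x i) (x j) -
        taylorSum r (x j - z) fun β => kernelPartial 0 β K (x i) z) -
        taylorSum r (x i - z) fun α => kernelPartial α 0 K z (x j) -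
          taylorSum r (x j - z) fun β => kernelPartial α β K z z| ≤
        ‖x i - z‖ ^ (r + γ) * ‖x j - z‖ ^ (r + γ) * κ := by
      intro i j
      rw [hκ, heq]
      exact abs_taylor_remainder_le_of_mixedHolder hγ0 (G := fun α β => kernelPartial α β K)
        hU hSU h₁ h₂ hcont htop i j
    calc _ ≤ ∑ j, ∑ i, |w' j| * |w' i| * (‖x i - z‖ ^ (r + γ) * ‖x j - z‖ ^ (r + γ) * κ) := by
          refine Finset.sum_le_sum fun j _ => Finset.sum_le_sum fun i _ => ?_
          refine (le_abs_self _).trans ?_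
          rw [abs_mul, abs_mul]
          exact mul_le_mul_of_nonneg_left (hR i j) (by positivity)
      _ = κ * (∑ j, |w' j| * ‖x j - z‖ ^ (r + γ)) ^ 2 := by
          rw [pow_two, Finset.sum_mul_sum, Finset.mul_sum]
          refine Finset.sum_congr rfl fun j _ => ?_
          rw [Finset.mul_sum]
          exact Finset.sum_congr rfl fun i _ => by ring
      _ ≤ κ * ρ ^ 2 := by gcongr
  have hbound : ∀ ν, HasNativeNorm s Ω K f ν →
      |diffOp k a f z - ∑ j, w j * f (x j)| ≤ ρ * √κ * ν := by
    intro ν hν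
    have hν0 : 0 ≤ ν := by
      obtain ⟨e, q, -, -, -, h⟩ := hν
      exact ge_of_tendsto' h fun n => Real.sqrt_nonneg _
    refine ((hmain f ν hν).2 w' (hw'.mono (le_max_left s (r + 1)))).trans ?_
    rw [mul_comm]
    refine mul_le_mul_of_nonneg_right ?_ hν0
    refine (Real.sqrt_le_sqrt hquad).trans_eq ?_
    rw [Real.sqrt_mul hκ0, Real.sqrt_sq hρ0, mul_comm]
  -- The native norm is an infimum. A positive factor ρ√κ is divided out before passing to it; if
  -- the factor is zero, the bound for the single value ν₀ suffices.
  rcases (mul_nonneg hρ0 (Real.sqrt_nonneg κ)).eq_or_lt with h0 | hpos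
  · have := hbound ν₀ hν₀
    rw [← h0, zero_mul] at this ⊢
    exact this
  · rw [← div_le_iff₀' hpos]
    exact le_csInf ⟨ν₀, hν₀⟩ fun ν hν => (div_le_iff₀' hpos).2 (hbound ν hν)
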